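/- Let $\Bbbk$ be a field and let $N\ge 0$ be an integer (the number of red strands, or punctures). Let $Q$ be the quiver with vertices $0,1,\dots,N$, a loop $s_i$ at each vertex $i$, and, for $0\le i<N$, an arrow $p_{i+1}\colon i\to i+1$ and an arrow $q_i\colon i+1\to i$. Composing paths from right to left, let $$A=\Bbbk Q\big/\bigl(\,q_ip_{i+1}=s_i,\quad p_{i+1}q_i=s_{i+1},\quad s_{i+1}p_{i+1}=p_{i+1}s_i,\quad s_iq_i=q_is_{i+1}\quad(0\le i<N)\,\bigr)$$ be the $\mathfrak{sl}_2$, $d=1$ KLRW algebra with $N$ red strands. Let $\mathrm{HH}^n(A)=\mathrm{Ext}^n_{A\otimes_{\Bbbk}A^{\mathrm{op}}}(A,A)$ denote its Hochschild cohomology, i.e. the cohomology of $\mathbf{R}\mathrm{Hom}$ from the diagonal $A$-bimodule to itself. Then, as $\Bbbk$-vector spaces, $$\mathrm{HH}^n(A)\cong\begin{cases}\bigoplus_{\ell\in\mathbb{Z}_{\ge 0}}\Bbbk, & n=0,1,\\[2pt] \Bbbk^{N-1}, & n=2 \text{ (for } N\ge 1),\\[2pt] 0, & n\ge 3.\end{cases}$$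 -/

import Mathlib

open scoped TensorProduct

universe u

noncomputable section

namespace KLRW

/-- The generators of the path algebra of the quiver with vertices `0, …, N`, a loop `s i` at every
vertex `i`, and, for `i = 0, …, N - 1`, an arrow `p i : i ⟶ i + 1` and an arrow `q i : i + 1 ⟶ i`.
The generator `e i` is the trivial path at `i`. -/
inductive Gen (N : ℕ) : Type
  | e (i : Fin (N + 1))
  | s (i : Fin (N + 1))
  | p (i : Fin N)
  | q (i : Fin N)

variable (k : Type u) [Field k] (N : ℕ)

/-- A generator as an element of the free algebra. -/
abbrev gen {N : ℕ} (g : Gen N) : FreeAlgebra k (Gen N) := FreeAlgebra.ι k g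

/-- The defining relations. Paths are composed from right to left, so an arrow `x : i ⟶ j`
satisfies `e j * x = x = x * e i`. For `i : Fin N`, the vertices `i.castSucc` and `i.succ` are the
vertices to the left and to the right of the `i`-th red strand. The first nine constructors present
the path algebra of the quiver; the last four are the KLRW relations. -/
inductive Rel : FreeAlgebra k (Gen N) → FreeAlgebra k (Gen N) → Prop
  | e_mul_self (i : Fin (N + 1)) : Rel (gen k (.e i) * gen k (.e i)) (gen k (.e i))
  | e_mul_ne (i j : Fin (N + 1)) (h : i ≠ j) : Rel (gen k (.e i) * gen k (.e j)) 0
  | sum_e : Rel (∑ i : Fin (N + 1), gen k (.e i)) 1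
  | s_target (i : Fin (N + 1)) : Rel (gen k (.e i) * gen k (.s i)) (gen k (.s i))
  | s_source (i : Fin (N + 1)) : Rel (gen k (.s i) * gen k (.e i)) (gen k (.s i))
  | p_target (i : Fin N) : Rel (gen k (.e i.succ) * gen k (.p i)) (gen k (.p i))
  | p_source (i : Fin N) : Rel (gen k (.p i) * gen k (.e i.castSucc)) (gen k (.p i))
  | q_target (i : Fin N) : Rel (gen k (.e i.castSucc) * gen k (.q i)) (gen k (.q i))
  | q_source (i : Fin N) : Rel (gen k (.q i) * gen k (.e i.succ)) (gen k (.q i))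
  | q_mul_p (i : Fin N) : Rel (gen k (.q i) * gen k (.p i)) (gen k (.s i.castSucc))
  | p_mul_q (i : Fin N) : Rel (gen k (.p i) * gen k (.q i)) (gen k (.s i.succ))
  | s_mul_p (i : Fin N) :
      Rel (gen k (.s i.succ) * gen k (.p i)) (gen k (.p i) * gen k (.s i.castSucc))
  | s_mul_q (i : Fin N) :
      Rel (gen k (.s i.castSucc) * gen k (.q i)) (gen k (.q i) * gen k (.s i.succ))

/-- The `𝔰𝔩₂`, `d = 1` KLRW algebra with `N` red strands, over the field `k`: the path algebra
of the above quiver modulo the KLRW relations. -/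
abbrev Alg : Type u := RingQuot (Rel k N)

end KLRW

section Hochschild

variable (k A : Type u) [Field k] [Ring A] [Algebra k A]

/-- The diagonal bimodule of the `k`-algebra `A`: the `A ⊗[k] Aᵐᵒᵖ`-module `A` with
`(a ⊗ op b) • x = a * x * b`. -/
def diagonalBimodule : ModuleCat.{u} (A ⊗[k] Aᵐᵒᵖ) :=
  letI : Module (A ⊗[k] Aᵐᵒᵖ) A := TensorProduct.Algebra.module
  ModuleCat.of (A ⊗[k] Aᵐᵒᵖ) A

/-- The Hochschild cohomology `HHⁿ(A) = Extⁿ(A, A)` of a `k`-algebra, in the category of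
`A`-bimodules over the field `k`. -/
abbrev HochschildCohomology (n : ℕ) : Type u :=
  CategoryTheory.Abelian.Ext.{u} (diagonalBimodule k A) (diagonalBimodule k A) n

end Hochschild

end

noncomputable section

/-! ### The presented algebra: universal property, center element, matrix representation -/

namespace KLRW

open Polynomial

variable (k : Type u) [Field k] {N : ℕ}

/-! The sum `z` of all loops is central (`ctr_commute`), and each component `e i * A * e j` is free
of rank one over `k[z]`, generated by the shortest path from `j` to `i`. Spanning is `mem_pathSpan`:
crossing a red strand and coming back costs a factor `z`. Freeness is `ev_mul_path_injective`, which
rests on a representation by matrices over `k[X]` in which `z` acts as `X`.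

Only the loop at `0` and the arrows `p i`, `q i` are needed as generators, with `s (i + 1)` standing
for `p i * q i`. The relations then reduce to `q i * p i = s i`, one for each `i < N`; the
commutation relations follow. This gives a complex of projective bimodules `Res₂ → Res₁ → Res₀ → A`,
with generators indexed by relations, arrows and vertices. It is exact at `Res₁` because, modulo the
image of `Res₂`, the generators of `Res₁` carry a derivation of `A` (`exact_diff₂_diff₁`). The map
out of `Res₂` is injective because it is triangular with regular diagonal entries
(`diff₂_injective`). So the projective dimension is at most two, and `HH^n` vanishes for `n ≥ 3`.

By the rank one statement, the bimodule maps from the resolution to `A` form a complex `k[X]^(N+1) →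
k[X]^(2N+1) → k[X]^N`. For a 1-cochain `c` put `a i = c (p i) + c (q i)`. By `cochain₁_comp_diff₂`
its coboundary is `a 0 * X - c (s 0)` at vertex `0` and `(a i - a (i-1)) * X` at each inner vertex
`i`. Hence the cokernel is one copy of `k[X]/(X) = k` for each of the `N - 1` inner vertices. For `N
≥ 1`, a cocycle has all `a i` equal to some `f` and `c (s 0) = f * X`; up to coboundaries only `f`
remains, so `HH^1` is `k[X]`. For `N = 0` the free loop coefficient gives `k[X]` as well. Finally
`HH^0` is the center, which is `k[z]`. -/

variable (N) in
/-- The algebra `Alg k N`, with `Ring` as the only source of its algebraic structure. -/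
def PathAlg : Type u := Alg k N

instance : Ring (PathAlg k N) := inferInstanceAs (Ring (Alg k N))

instance : Algebra k (PathAlg k N) := inferInstanceAs (Algebra k (Alg k N))

variable (N) in
/-- The projection from the free algebra. -/
def quotMap : FreeAlgebra k (Gen N) →ₐ[k] PathAlg k N := RingQuot.mkAlgHom k (Rel k N)

/-- The trivial path at the vertex `i`. -/
def idem (i : Fin (N + 1)) : PathAlg k N := quotMap k N (gen k (.e i))

/-- The loop at the vertex `i`. -/
def loop (i : Fin (N + 1)) : PathAlg k N := quotMap k N (gen k (.s i))

/-- The arrow that crosses the `i`-th red strand from left to right. -/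
def up (i : Fin N) : PathAlg k N := quotMap k N (gen k (.p i))

/-- The arrow that crosses the `i`-th red strand from right to left. -/
def down (i : Fin N) : PathAlg k N := quotMap k N (gen k (.q i))

lemma mk_eq {x y : FreeAlgebra k (Gen N)} (h : Rel k N x y) :
    quotMap k N x = quotMap k N y :=
  RingQuot.mkAlgHom_rel k h

lemma quotMap_surjective : Function.Surjective (quotMap k N) :=
  RingQuot.mkAlgHom_surjective k (Rel k N)

@[simp] lemma idem_mul_self (i : Fin (N + 1)) : idem k i * idem k i = idem k i := by
  simpa [idem] using mk_eq k (.e_mul_self i)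

lemma idem_mul_ne {i j : Fin (N + 1)} (h : i ≠ j) : idem k i * idem k j = 0 := by
  simpa [idem] using mk_eq k (.e_mul_ne i j h)

lemma sum_idem : ∑ i : Fin (N + 1), idem k i = 1 := by
  simpa [idem] using mk_eq k (.sum_e (N := N))

@[simp] lemma idem_mul_loop (i : Fin (N + 1)) : idem k i * loop k i = loop k i := by
  simpa [idem, loop] using mk_eq k (.s_target i)

@[simp] lemma loop_mul_idem (i : Fin (N + 1)) : loop k i * idem k i = loop k i := by
  simpa [idem, loop] using mk_eq k (.s_source i)

@[simp] lemma idem_mul_up (i : Fin N) : idem k i.succ * up k i = up k i := by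
  simpa [idem, up] using mk_eq k (.p_target i)

@[simp] lemma up_mul_idem (i : Fin N) : up k i * idem k i.castSucc = up k i := by
  simpa [idem, up] using mk_eq k (.p_source i)

@[simp] lemma idem_mul_down (i : Fin N) : idem k i.castSucc * down k i = down k i := by
  simpa [idem, down] using mk_eq k (.q_target i)

@[simp] lemma down_mul_idem (i : Fin N) : down k i * idem k i.succ = down k i := by
  simpa [idem, down] using mk_eq k (.q_source i)

@[simp] lemma down_mul_up (i : Fin N) : down k i * up k i = loop k i.castSucc := by
  simpa [loop, up, down] using mk_eq k (.q_mul_p i)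

@[simp] lemma up_mul_down (i : Fin N) : up k i * down k i = loop k i.succ := by
  simpa [loop, up, down] using mk_eq k (.p_mul_q i)

lemma loop_mul_up (i : Fin N) : loop k i.succ * up k i = up k i * loop k i.castSucc := by
  simpa [loop, up, down] using mk_eq k (.s_mul_p i)

lemma loop_mul_down (i : Fin N) : loop k i.castSucc * down k i = down k i * loop k i.succ := by
  simpa [loop, up, down] using mk_eq k (.s_mul_q i)

variable {k} in
/-- A subalgebra that contains the generators is everything. -/
lemma mem_of_generators_mem (S : Subalgebra k (PathAlg k N)) (he : ∀ i, idem k i ∈ S)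
    (hs : ∀ i, loop k i ∈ S) (hp : ∀ i, up k i ∈ S) (hq : ∀ i, down k i ∈ S) (a : PathAlg k N) :
    a ∈ S := by
  obtain ⟨x, rfl⟩ := quotMap_surjective k a
  induction x using FreeAlgebra.induction with
  | grade0 r => simp
  | grade1 g =>
    cases g with
    | e i => exact he i
    | s i => exact hs i
    | p i => exact hp i
    | q i => exact hq i
  | mul x y hx hy => simpa using S.mul_mem hx hy
  | add x y hx hy => simpa using S.add_mem hx hy

section lift

variable {k} {B : Type*} [Ring B] [Algebra k B]

/-- The image of a generator under the map determined by four families. -/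
def genMap (e s : Fin (N + 1) → B) (p q : Fin N → B) : Gen N → B
  | .e i => e i
  | .s i => s i
  | .p i => p i
  | .q i => q i

/-- The universal property of the algebra. -/
lemma exists_lift (e s : Fin (N + 1) → B) (p q : Fin N → B)
    (hee : ∀ i, e i * e i = e i) (hne : ∀ i j, i ≠ j → e i * e j = 0) (hsum : ∑ i, e i = 1)
    (hes : ∀ i, e i * s i = s i) (hse : ∀ i, s i * e i = s i)
    (hep : ∀ i : Fin N, e i.succ * p i = p i) (hpe : ∀ i : Fin N, p i * e i.castSucc = p i)
    (heq : ∀ i : Fin N, e i.castSucc * q i = q i) (hqe : ∀ i : Fin N, q i * e i.succ = q i)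
    (hqp : ∀ i : Fin N, q i * p i = s i.castSucc) (hpq : ∀ i : Fin N, p i * q i = s i.succ) :
    ∃ φ : PathAlg k N →ₐ[k] B, (∀ i, φ (idem k i) = e i) ∧ (∀ i, φ (loop k i) = s i) ∧
      (∀ i, φ (up k i) = p i) ∧ ∀ i, φ (down k i) = q i := by
  have h : ∀ ⦃x y : FreeAlgebra k (Gen N)⦄, Rel k N x y →
      FreeAlgebra.lift k (genMap e s p q) x = FreeAlgebra.lift k (genMap e s p q) y := by
    intro x y hxy
    cases hxy with
    | e_mul_self i => simp [genMap, hee]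
    | e_mul_ne i j h => simp [genMap, hne i j h]
    | sum_e => simp [genMap, hsum]
    | s_target i => simp [genMap, hes]
    | s_source i => simp [genMap, hse]
    | p_target i => simp [genMap, hep]
    | p_source i => simp [genMap, hpe]
    | q_target i => simp [genMap, heq]
    | q_source i => simp [genMap, hqe]
    | q_mul_p i => simp [genMap, hqp]
    | p_mul_q i => simp [genMap, hpq]
    -- The commutation relations are redundant: once `s` is written as `p q` or `q p`, they are
    -- associativity of `p q p` and of `q p q`.
    | s_mul_p i => simp [genMap, ← hqp, ← hpq, mul_assoc]
    | s_mul_q i => simp [genMap, ← hqp, ← hpq, mul_assoc]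
  have hφ : ∀ g, RingQuot.liftAlgHom k ⟨FreeAlgebra.lift k (genMap e s p q), h⟩
      (RingQuot.mkAlgHom k (Rel k N) (gen k g)) = genMap e s p q g := by simp
  exact ⟨RingQuot.liftAlgHom k ⟨FreeAlgebra.lift k (genMap e s p q), h⟩,
    fun i ↦ hφ (.e i), fun i ↦ hφ (.s i), fun i ↦ hφ (.p i), fun i ↦ hφ (.q i)⟩

end lift

/-- The central element `z`, the sum of all loops. -/
def ctr (N : ℕ) : PathAlg k N := ∑ i, loop k i

lemma idem_mul_loop_ne {i j : Fin (N + 1)} (h : i ≠ j) : idem k i * loop k j = 0 := by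
  rw [← idem_mul_loop, ← mul_assoc, idem_mul_ne k h, zero_mul]

lemma loop_mul_idem_ne {i j : Fin (N + 1)} (h : i ≠ j) : loop k i * idem k j = 0 := by
  rw [← loop_mul_idem, mul_assoc, idem_mul_ne k h, mul_zero]

lemma ctr_mul_idem (i : Fin (N + 1)) : ctr k N * idem k i = loop k i := by
  rw [ctr, Finset.sum_mul, Finset.sum_eq_single i (fun j _ h ↦ loop_mul_idem_ne k h) (by simp),
    loop_mul_idem]

lemma idem_mul_ctr (i : Fin (N + 1)) : idem k i * ctr k N = loop k i := by
  rw [ctr, Finset.mul_sum, Finset.sum_eq_single i (fun j _ h ↦ idem_mul_loop_ne k h.symm) (by simp),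
    idem_mul_loop]

lemma ctr_commute (a : PathAlg k N) : Commute (ctr k N) a := by
  have key := mem_of_generators_mem (Subalgebra.centralizer k {ctr k N}) ?_ ?_ ?_ ?_ a
  · exact (Subalgebra.mem_centralizer_iff k).1 key _ rfl
  all_goals
    intro i
    rw [Subalgebra.mem_centralizer_iff]
    rintro _ rfl
  · rw [ctr_mul_idem, idem_mul_ctr]
  · rw [← ctr_mul_idem, mul_assoc, ctr_mul_idem, ← idem_mul_ctr]
  · rw [← idem_mul_up, ← mul_assoc, ctr_mul_idem, loop_mul_up, idem_mul_up, ← idem_mul_ctr,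
      ← mul_assoc, up_mul_idem]
  · rw [← idem_mul_down, ← mul_assoc, ctr_mul_idem, loop_mul_down, idem_mul_down, ← idem_mul_ctr,
      ← mul_assoc, down_mul_idem]

/-- The matrix representation over `k[X]`. -/
lemma exists_rep (N : ℕ) : ∃ φ : PathAlg k N →ₐ[k] Matrix (Fin (N + 1)) (Fin (N + 1)) k[X],
    (∀ i, φ (idem k i) = Matrix.single i i 1) ∧ ∀ i, φ (loop k i) = Matrix.single i i X := by
  -- The factor `X` sits on the downward arrows only, so that both `q p` and `p q` become `X` times
  -- an idempotent.
  obtain ⟨φ, h1, h2, -⟩ := exists_lift (k := k) (N := N)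
    (fun i ↦ Matrix.single i i (1 : k[X])) (fun i ↦ Matrix.single i i X)
    (fun i ↦ Matrix.single i.succ i.castSucc 1) (fun i ↦ Matrix.single i.castSucc i.succ X)
    (by simp) (fun i j h ↦ by simp [h]) Matrix.sum_single_one (by simp) (by simp) (by simp)
    (by simp) (by simp) (by simp) (by simp) (by simp)
  exact ⟨φ, h1, h2⟩

end KLRW

/-! ### Components of the algebra are free of rank one over the polynomials in `z` -/

namespace KLRW

open Polynomial

variable (k : Type u) [Field k] {N : ℕ}

/-- The polynomial `f` evaluated at the central element. -/
abbrev ev (N : ℕ) (f : k[X]) : PathAlg k N := aeval (ctr k N) f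

variable {k} in
lemma ev_commute (f : k[X]) (a : PathAlg k N) : Commute (ev k N f) a :=
  Algebra.commute_of_mem_adjoin_singleton_of_commute (aeval_mem_adjoin_singleton k _)
    (ctr_commute k a).symm |>.symm

variable {k} in
-- The matrix representation sends `z` to the scalar matrix `X`, so the `(i, i)` entry of the image
-- of the product is `f` itself.
lemma ev_mul_idem_injective {f : k[X]} (i : Fin (N + 1)) (h : ev k N f * idem k i = 0) :
    f = 0 := by
  obtain ⟨φ, he, hs⟩ := exists_rep k N
  have hz : φ (ctr k N) = algebraMap k[X] _ X := by
    rw [ctr, map_sum, Algebra.algebraMap_eq_smul_one, ← Matrix.sum_single_one, Finset.smul_sum]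
    simp [hs, Matrix.smul_single]
  have h1 : φ (ev k N f) = algebraMap k[X] _ f := by
    rw [ev, ← aeval_algHom_apply, hz, aeval_algebraMap_apply]
    simp
  have h2 := congrArg (fun M ↦ M i i) (congrArg φ h)
  simpa [h1, he, Matrix.algebraMap_eq_diagonal] using h2

/-- The sum of all arrows `i ⟶ i + 1`. -/
def ups (N : ℕ) : PathAlg k N := ∑ i, up k i

/-- The sum of all arrows `i + 1 ⟶ i`. -/
def downs (N : ℕ) : PathAlg k N := ∑ i, down k i

lemma ups_mul_idem (i : Fin N) : ups k N * idem k i.castSucc = up k i := by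
  rw [ups, Finset.sum_mul, Finset.sum_eq_single i _ (by simp), up_mul_idem]
  intro j _ h
  rw [← up_mul_idem, mul_assoc, idem_mul_ne k (by simpa using h), mul_zero]

lemma downs_mul_idem (i : Fin N) : downs k N * idem k i.succ = down k i := by
  rw [downs, Finset.sum_mul, Finset.sum_eq_single i _ (by simp), down_mul_idem]
  intro j _ h
  rw [← down_mul_idem, mul_assoc, idem_mul_ne k (by simpa using h), mul_zero]

lemma idem_mul_ups_pow (n : ℕ) (i j : Fin (N + 1)) (h : (i : ℕ) = j + n) :
    idem k i * (ups k N ^ n * idem k j) = ups k N ^ n * idem k j := by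
  induction n generalizing i with
  | zero => obtain rfl : i = j := Fin.ext h; simp
  | succ n ih =>
    obtain ⟨i, rfl⟩ := Fin.exists_succ_eq.2 (show i ≠ 0 by rintro rfl; simp at h)
    have := ih i.castSucc (by simp at h ⊢; omega)
    rw [pow_succ', mul_assoc, ← this, ← mul_assoc (ups k N), ups_mul_idem, ← mul_assoc, idem_mul_up]

lemma idem_mul_downs_pow (n : ℕ) (i j : Fin (N + 1)) (h : (j : ℕ) = i + n) :
    idem k i * (downs k N ^ n * idem k j) = downs k N ^ n * idem k j := by
  induction n generalizing i with
  | zero => obtain rfl : i = j := Fin.ext h.symm; simp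
  | succ n ih =>
    obtain ⟨i, rfl⟩ := Fin.exists_castSucc_eq.2 (show i ≠ Fin.last N by
      rintro rfl; have := j.2; simp at h; omega)
    have := ih i.succ (by simp at h ⊢; omega)
    rw [pow_succ', mul_assoc, ← this, ← mul_assoc (downs k N), downs_mul_idem, ← mul_assoc,
      idem_mul_down]

/-- The shortest path from `j` to `i`. -/
def path (i j : Fin (N + 1)) : PathAlg k N :=
  if j ≤ i then ups k N ^ (i - j : ℕ) * idem k j else downs k N ^ (j - i : ℕ) * idem k j

@[simp] lemma path_self (i : Fin (N + 1)) : path k i i = idem k i := by simp [path]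

@[simp] lemma path_succ_castSucc (i : Fin N) : path k i.succ i.castSucc = up k i := by
  rw [path, if_pos i.castSucc_lt_succ.le]
  simp [ups_mul_idem]

@[simp] lemma path_castSucc_succ (i : Fin N) : path k i.castSucc i.succ = down k i := by
  rw [path, if_neg i.castSucc_lt_succ.not_ge]
  simp [downs_mul_idem]

@[simp] lemma idem_mul_path (i j : Fin (N + 1)) : idem k i * path k i j = path k i j := by
  rw [path]
  split_ifs with h
  · exact idem_mul_ups_pow k _ _ _ (by rw [Fin.le_def] at h; omega)
  · exact idem_mul_downs_pow k _ _ _ (by rw [Fin.le_def] at h; omega)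

lemma path_succ_of_le {i : Fin N} {j : Fin (N + 1)} (h : j ≤ i.castSucc) :
    path k i.succ j = up k i * path k i.castSucc j := by
  rw [← ups_mul_idem, mul_assoc, idem_mul_path, path, path, if_pos h,
    if_pos (h.trans i.castSucc_lt_succ.le), ← mul_assoc, ← pow_succ']
  congr 2
  rw [Fin.le_def] at h
  simp at h ⊢
  omega

lemma path_castSucc_of_le {i : Fin N} {j : Fin (N + 1)} (h : i.succ ≤ j) :
    path k i.castSucc j = down k i * path k i.succ j := by
  rcases h.eq_or_lt with rfl | h'
  · simp
  rw [← downs_mul_idem, mul_assoc, idem_mul_path, path, path, if_neg h'.not_ge,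
    if_neg (i.castSucc_lt_succ.trans h').not_ge, ← mul_assoc, ← pow_succ']
  congr 2
  rw [Fin.lt_def] at h'
  simp at h' ⊢
  omega

/-- The path has just crossed strand `i` downwards; crossing it back creates a loop, that is, a
factor `z`. -/
lemma up_mul_path_of_le {i : Fin N} {j : Fin (N + 1)} (h : i.succ ≤ j) :
    up k i * path k i.castSucc j = ctr k N * path k i.succ j := by
  rw [path_castSucc_of_le k h, ← mul_assoc, up_mul_down, ← ctr_mul_idem, mul_assoc, idem_mul_path]

lemma down_mul_path_of_le {i : Fin N} {j : Fin (N + 1)} (h : j ≤ i.castSucc) :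
    down k i * path k i.succ j = ctr k N * path k i.castSucc j := by
  rw [path_succ_of_le k h, ← mul_assoc, down_mul_up, ← ctr_mul_idem, mul_assoc, idem_mul_path]

/-- Every path is a left divisor of a power of the central element times an idempotent. -/
lemma exists_mul_path (i j : Fin (N + 1)) :
    ∃ (y : PathAlg k N) (n : ℕ), y * path k i j = ctr k N ^ n * idem k j := by
  rcases le_total j i with h | h
  · induction i using Fin.induction with
    | zero => obtain rfl : j = 0 := by simpa using h
              exact ⟨1, 0, by simp⟩
    | succ i ih =>
      rcases h.eq_or_lt with rfl | h'
      · exact ⟨1, 0, by simp⟩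
      have h'' : j ≤ i.castSucc := Fin.le_castSucc_iff.2 h'
      obtain ⟨y, n, hy⟩ := ih h''
      refine ⟨y * down k i, n + 1, ?_⟩
      rw [mul_assoc, down_mul_path_of_le k h'', ← mul_assoc, ← (ctr_commute k y).eq, mul_assoc, hy,
        pow_succ', mul_assoc]
  · induction i using Fin.reverseInduction with
    | last => obtain rfl : j = Fin.last N := by simpa using h
              exact ⟨1, 0, by simp⟩
    | cast i ih =>
      rcases h.eq_or_lt with rfl | h'
      · exact ⟨1, 0, by simp⟩
      have h'' : i.succ ≤ j := Fin.castSucc_lt_iff_succ_le.1 h'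
      obtain ⟨y, n, hy⟩ := ih h''
      refine ⟨y * up k i, n + 1, ?_⟩
      rw [mul_assoc, up_mul_path_of_le k h'', ← mul_assoc, ← (ctr_commute k y).eq, mul_assoc, hy,
        pow_succ', mul_assoc]

variable {k} in
-- Completing the path to a closed one turns it into a power of `z` at `j`, which reduces the claim
-- to an idempotent and the polynomial `f * X ^ n`.
lemma ev_mul_path_injective {f : k[X]} (i j : Fin (N + 1)) (h : ev k N f * path k i j = 0) :
    f = 0 := by
  obtain ⟨y, n, hy⟩ := exists_mul_path k i j
  have h1 : ev k N (f * X ^ n) * idem k j = 0 := by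
    rw [ev, map_mul, map_pow, aeval_X, mul_assoc, ← hy, ← mul_assoc, (ev_commute f y).eq, mul_assoc,
      h, mul_zero]
  simpa using ev_mul_idem_injective j h1

/-- The elements all of whose components are multiples of shortest paths. -/
def pathSpan (N : ℕ) : Submodule k (PathAlg k N) where
  carrier := {a | ∀ i j, ∃ f : k[X], idem k i * a * idem k j = ev k N f * path k i j}
  zero_mem' i j := ⟨0, by simp⟩
  add_mem' := by
    intro a b ha hb i j
    obtain ⟨f, hf⟩ := ha i j
    obtain ⟨g, hg⟩ := hb i j
    exact ⟨f + g, by rw [mul_add, add_mul, hf, hg, ← add_mul, ← map_add]⟩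
  smul_mem' := by
    intro c a ha i j
    obtain ⟨f, hf⟩ := ha i j
    exact ⟨c • f, by simp [hf]⟩

lemma mul_mem_pathSpan {i j : Fin (N + 1)} {x b : PathAlg k N} (hx : x = idem k i * x * idem k j)
    (h : ∀ l, ∃ n : ℕ, x * path k j l = ctr k N ^ n * path k i l) (hb : b ∈ pathSpan k N) :
    x * b ∈ pathSpan k N := by
  intro i' l
  by_cases hi : i' = i
  · subst hi
    obtain ⟨n, hn⟩ := h l
    obtain ⟨f, hf⟩ := hb j l
    refine ⟨f * X ^ n, ?_⟩
    have h2 : idem k i' * x = x * idem k j := by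
      rw [hx]; simp [← mul_assoc]; simp [mul_assoc]
    rw [← mul_assoc, h2, mul_assoc, mul_assoc, ← mul_assoc (idem k j), hf, ← mul_assoc,
      ← (ev_commute f x).eq, mul_assoc, hn]
    simp [mul_assoc]
  · refine ⟨0, ?_⟩
    rw [hx]
    simp only [← mul_assoc]
    rw [idem_mul_ne k hi]
    simp

/-- Closure of `pathSpan` under products is not immediate, but the elements whose left
multiplication preserves it form a subalgebra. That subalgebra contains the generators, hence `a`,
and `a` is then applied to `1`. -/
lemma mem_pathSpan (a : PathAlg k N) : a ∈ pathSpan k N := by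
  let S : Subalgebra k (PathAlg k N) :=
    { carrier := {a | ∀ b ∈ pathSpan k N, a * b ∈ pathSpan k N}
      mul_mem' := fun {x y} hx hy b hb ↦ by rw [mul_assoc]; exact hx _ (hy _ hb)
      add_mem' := fun {x y} hx hy b hb ↦ by
        rw [add_mul]; exact (pathSpan k N).add_mem (hx _ hb) (hy _ hb)
      algebraMap_mem' := fun r b hb ↦ by
        rw [← Algebra.smul_def]; exact (pathSpan k N).smul_mem r hb }
  have h1 : (1 : PathAlg k N) ∈ pathSpan k N := by
    intro i j
    by_cases h : i = j
    · subst h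
      exact ⟨1, by simp⟩
    · exact ⟨0, by simp [idem_mul_ne k h]⟩
  have h := mem_of_generators_mem S ?_ ?_ ?_ ?_ a 1 h1
  · simpa using h
  · intro i b hb
    exact mul_mem_pathSpan k (i := i) (j := i) (by simp) (fun l ↦ ⟨0, by simp⟩) hb
  · intro i b hb
    exact mul_mem_pathSpan k (i := i) (j := i) (by simp) (fun l ↦ ⟨1, by
      rw [← ctr_mul_idem, mul_assoc, idem_mul_path, pow_one]⟩) hb
  · intro i b hb
    refine mul_mem_pathSpan k (i := i.succ) (j := i.castSucc) (by simp) (fun l ↦ ?_) hb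
    rcases le_or_gt l i.castSucc with h | h
    · exact ⟨0, by simp [path_succ_of_le k h]⟩
    · exact ⟨1, by rw [up_mul_path_of_le k (Fin.castSucc_lt_iff_succ_le.1 h), pow_one]⟩
  · intro i b hb
    refine mul_mem_pathSpan k (i := i.castSucc) (j := i.succ) (by simp) (fun l ↦ ?_) hb
    rcases le_or_gt l i.castSucc with h | h
    · exact ⟨1, by rw [down_mul_path_of_le k h, pow_one]⟩
    · exact ⟨0, by simp [path_castSucc_of_le k (Fin.castSucc_lt_iff_succ_le.1 h)]⟩

variable {k} in
lemma exists_component (a : PathAlg k N) (i j : Fin (N + 1)) :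
    ∃ f : k[X], idem k i * a * idem k j = ev k N f * path k i j :=
  mem_pathSpan k a i j

variable {k} in
lemma eq_zero_of_components {a : PathAlg k N} (h : ∀ i j, idem k i * a * idem k j = 0) : a = 0 := by
  rw [← one_mul a, ← mul_one (1 * a), ← sum_idem, Finset.sum_mul, Finset.sum_mul_sum]
  exact Finset.sum_eq_zero fun i _ ↦ Finset.sum_eq_zero fun j _ ↦ h i j

variable {k} in
lemma eq_zero_of_mul_ctr {a : PathAlg k N} (h : a * ctr k N = 0) : a = 0 := by
  refine eq_zero_of_components fun i j ↦ ?_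
  obtain ⟨f, hf⟩ := exists_component a i j
  have h1 : ev k N (X * f) * path k i j = 0 := by
    rw [ev, map_mul, aeval_X, mul_assoc, ← hf, ← mul_assoc, ← mul_assoc, (ctr_commute k _).eq,
      mul_assoc (idem k i), (ctr_commute k a).eq, h]
    simp
  rw [hf, (mul_eq_zero_iff_left X_ne_zero).1 (ev_mul_path_injective i j h1)]
  simp

end KLRW

/-! ### Extension groups from a projective resolution of length two -/

section ExtOfResolution

open CategoryTheory Abelian

namespace CategoryTheory.ShortComplex.ShortExact

universe w v u'

variable {C : Type u'} [Category.{v} C] [Abelian C] [HasExt.{w} C] {S : ShortComplex C}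
  (hS : S.ShortExact) (R : Type*) [CommRing R] [Linear R C] (Y : C)

/-- The connecting map from extensions of degree zero to first extensions. -/
abbrev connecting : Ext.{w} S.X₁ Y 0 →ₗ[R] Ext.{w} S.X₃ Y 1 :=
  hS.extClass.precompOfLinear R Y (add_zero 1)

lemma connecting_surjective [Projective S.X₂] : Function.Surjective (hS.connecting R Y) :=
  fun x ↦ Ext.contravariant_sequence_exact₃ hS Y x (Ext.eq_zero_of_projective _) (add_zero 1)

lemma connecting_mk₀_eq_zero_iff (f : S.X₁ ⟶ Y) :
    hS.connecting R Y (Ext.mk₀ f) = 0 ↔ ∃ g : S.X₂ ⟶ Y, S.f ≫ g = f := by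
  constructor
  · intro h
    obtain ⟨y, hy⟩ := Ext.contravariant_sequence_exact₁ hS Y _ (add_zero 1) h
    obtain ⟨g, rfl⟩ := (Ext.mk₀_bijective _ _).2 y
    refine ⟨g, (Ext.mk₀_bijective _ _).1 ?_⟩
    rwa [Ext.mk₀_comp_mk₀] at hy
  · rintro ⟨g, rfl⟩
    change hS.extClass.comp (Ext.mk₀ (S.f ≫ g)) (add_zero 1) = 0
    rw [← Ext.mk₀_comp_mk₀, hS.extClass_comp_assoc]

/-- Dimension shifting: both neighbouring terms of the long exact sequence are positive extension
groups of the projective `S.X₂`. The source degree is `n + 1` because from degree zero the map need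
not be injective. -/
lemma extClass_precomp_bijective [Projective S.X₂] (n m : ℕ) (h : 1 + (n + 1) = m) :
    Function.Bijective (hS.extClass.precompOfLinear R Y h) := by
  subst h
  constructor
  · rw [injective_iff_map_eq_zero]
    intro x hx
    obtain ⟨y, hy⟩ := Ext.contravariant_sequence_exact₁ hS Y x rfl hx
    rw [← hy, Ext.eq_zero_of_projective y, Ext.comp_zero]
  · intro x
    have h0 : (Ext.mk₀ S.g).comp x (zero_add _) = 0 := by
      have : Subsingleton (Ext.{w} S.X₂ Y (1 + (n + 1))) := by
        rw [add_comm]; exact Ext.subsingleton_of_projective _ _ _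
      exact Subsingleton.elim _ _
    exact Ext.contravariant_sequence_exact₃ hS Y x h0 rfl

end CategoryTheory.ShortComplex.ShortExact

namespace ModuleCat

variable (k : Type u) [Field k] {Λ : Type u} [Ring Λ] [Algebra k Λ]
  {P₀ P₁ P₂ M Y : Type u} [AddCommGroup P₀] [AddCommGroup P₁] [AddCommGroup P₂]
  [AddCommGroup M] [AddCommGroup Y] [Module Λ P₀] [Module Λ P₁] [Module Λ P₂] [Module Λ M]
  [Module Λ Y] [Module k Y] [IsScalarTower k Λ Y]

/-- Linear maps as extensions of degree zero, linearly over the base field. -/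
def homEquivExt (P Y : Type u) [AddCommGroup P] [Module Λ P] [AddCommGroup Y] [Module Λ Y]
    [Module k Y] [IsScalarTower k Λ Y] :
    (P →ₗ[Λ] Y) ≃ₗ[k] Ext.{u} (of Λ P) (of Λ Y) 0 :=
  LinearEquiv.ofBijective
    { toFun f := Ext.mk₀ (ofHom f)
      map_add' f g := by rw [← Ext.mk₀_add]; rfl
      map_smul' c f := by
        rw [RingHom.id_apply, ← Ext.mk₀_smul]
        congr 1
        refine ModuleCat.hom_ext (LinearMap.ext fun x ↦ ?_)
        exact (algebraMap_smul Λ c (f x)).symm }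
    ((Ext.mk₀_bijective _ _).comp ⟨fun _ _ h ↦ congrArg ModuleCat.Hom.hom h, fun f ↦ ⟨f.hom, rfl⟩⟩)

variable {d₂ : P₂ →ₗ[Λ] P₁} {d₁ : P₁ →ₗ[Λ] P₀} {π : P₀ →ₗ[Λ] M}

variable (π) in
/-- The inclusion of the kernel of `π` followed by `π`. -/
abbrev kernelComplex : ShortComplex (ModuleCat.{u} Λ) :=
  ShortComplex.mk (ofHom (LinearMap.ker π).subtype) (ofHom π) (by ext x; exact x.2)

lemma kernelComplex_shortExact (hπ : Function.Surjective π) : (kernelComplex π).ShortExact where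
  exact := by
    rw [ShortComplex.ShortExact.moduleCat_exact_iff_function_exact]
    exact LinearMap.exact_subtype_ker_map π
  mono_f := (ModuleCat.mono_iff_injective _).2 (LinearMap.ker π).injective_subtype
  epi_g := (ModuleCat.epi_iff_surjective _).2 hπ

/-- The first differential with values in the first syzygy. -/
abbrev toSyzygy (h₁ : Function.Exact d₁ π) : P₁ →ₗ[Λ] LinearMap.ker π :=
  d₁.codRestrict _ (fun x ↦ h₁.apply_apply_eq_zero x)

lemma toSyzygy_surjective (h₁ : Function.Exact d₁ π) : Function.Surjective (toSyzygy h₁) := by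
  rintro ⟨x, hx⟩
  obtain ⟨y, rfl⟩ := (h₁ x).1 hx
  exact ⟨y, rfl⟩

/-- The second syzygy sequence. -/
abbrev syzygyComplex (h₁ : Function.Exact d₁ π) (h₂ : Function.Exact d₂ d₁) :
    ShortComplex (ModuleCat.{u} Λ) :=
  ShortComplex.mk (ofHom d₂) (ofHom (toSyzygy h₁)) (by
    refine ModuleCat.hom_ext (LinearMap.ext fun x ↦ ?_)
    exact Subtype.ext (h₂.apply_apply_eq_zero x))

lemma syzygyComplex_shortExact (h₁ : Function.Exact d₁ π) (h₂ : Function.Exact d₂ d₁)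
    (hd : Function.Injective d₂) : (syzygyComplex h₁ h₂).ShortExact where
  exact := by
    rw [ShortComplex.ShortExact.moduleCat_exact_iff_function_exact]
    intro x
    exact Subtype.ext_iff.trans (h₂ x)
  mono_f := (ModuleCat.mono_iff_injective _).2 hd
  epi_g := (ModuleCat.epi_iff_surjective _).2 (toSyzygy_surjective h₁)

variable [Module.Projective Λ P₀]

/-- The first extension group, computed by a resolution. -/
lemma exists_ext_one (hπ : Function.Surjective π) (h₁ : Function.Exact d₁ π)
    (h₂ : Function.Exact d₂ d₁) :
    ∃ δ : LinearMap.ker (LinearMap.lcomp k Y d₂) →ₗ[k] Ext.{u} (of Λ M) (of Λ Y) 1,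
      Function.Surjective δ ∧ ∀ f, δ f = 0 ↔ ∃ g : P₀ →ₗ[Λ] Y, g ∘ₗ d₁ = f.1 := by
  have hS := kernelComplex_shortExact hπ
  have : Projective (kernelComplex π).X₂ := (IsProjective.iff_projective P₀).1 inferInstance
  -- Since `P₂ → P₁ → ker π → 0` is exact, maps out of the first syzygy are the same as cocycles on
  -- `P₁`.
  let r : (LinearMap.ker π →ₗ[Λ] Y) →ₗ[k] LinearMap.ker (LinearMap.lcomp k Y d₂) :=
    (LinearMap.lcomp k Y (toSyzygy h₁)).codRestrict _ (by
      intro f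
      ext x
      have : toSyzygy h₁ (d₂ x) = 0 := Subtype.ext (h₂.apply_apply_eq_zero x)
      simp [this])
  have hr : Function.Bijective r := by
    constructor
    · intro f g h
      ext x
      obtain ⟨y, rfl⟩ := toSyzygy_surjective h₁ x
      exact LinearMap.congr_fun (congrArg Subtype.val h) y
    · rintro ⟨f, hf⟩
      have hker : LinearMap.ker (toSyzygy h₁) ≤ LinearMap.ker f := by
        intro x hx
        obtain ⟨y, rfl⟩ := (h₂ x).1 (congrArg Subtype.val hx)
        exact LinearMap.congr_fun hf y
      refine ⟨(LinearMap.ker (toSyzygy h₁)).liftQ f hker ∘ₗ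
        ((toSyzygy h₁).quotKerEquivOfSurjective (toSyzygy_surjective h₁)).symm, ?_⟩
      refine Subtype.ext (LinearMap.ext fun x ↦ ?_)
      have : ((toSyzygy h₁).quotKerEquivOfSurjective (toSyzygy_surjective h₁)).symm
          (toSyzygy h₁ x) = Submodule.Quotient.mk x := by
        rw [LinearEquiv.symm_apply_eq]; rfl
      exact (congrArg _ this).trans rfl
  let e := LinearEquiv.ofBijective r hr
  refine ⟨hS.connecting k (of Λ Y) ∘ₗ (homEquivExt (Λ := Λ) k (LinearMap.ker π) Y).toLinearMap ∘ₗ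
    e.symm.toLinearMap, ?_, ?_⟩
  · exact (hS.connecting_surjective k _).comp
      ((homEquivExt (Λ := Λ) k (LinearMap.ker π) Y).surjective.comp e.symm.surjective)
  · intro f
    obtain ⟨f, rfl⟩ := e.surjective f
    change hS.connecting k _ (homEquivExt k _ Y (e.symm (e f))) = 0 ↔ _
    rw [e.symm_apply_apply]
    refine (hS.connecting_mk₀_eq_zero_iff k (of Λ Y) (ofHom f)).trans ?_
    constructor
    · rintro ⟨g, hg⟩
      refine ⟨g.hom, LinearMap.ext fun x ↦ ?_⟩
      exact LinearMap.congr_fun (congrArg ModuleCat.Hom.hom hg) (toSyzygy h₁ x)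
    · rintro ⟨g, hg⟩
      refine ⟨ofHom g, ModuleCat.hom_ext (LinearMap.ext fun x ↦ ?_)⟩
      obtain ⟨y, rfl⟩ := toSyzygy_surjective h₁ x
      exact LinearMap.congr_fun hg y

variable [Module.Projective Λ P₁]

/-- The second extension group, computed by a resolution of length two. -/
lemma exists_ext_two (hπ : Function.Surjective π) (h₁ : Function.Exact d₁ π)
    (h₂ : Function.Exact d₂ d₁) (hd : Function.Injective d₂) :
    ∃ δ : (P₂ →ₗ[Λ] Y) →ₗ[k] Ext.{u} (of Λ M) (of Λ Y) 2,
      Function.Surjective δ ∧ ∀ f, δ f = 0 ↔ ∃ g : P₁ →ₗ[Λ] Y, g ∘ₗ d₂ = f := by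
  have hS := kernelComplex_shortExact hπ
  have hT := syzygyComplex_shortExact h₁ h₂ hd
  have : Projective (kernelComplex π).X₂ := (IsProjective.iff_projective P₀).1 inferInstance
  have : Projective (syzygyComplex h₁ h₂).X₂ := (IsProjective.iff_projective P₁).1 inferInstance
  -- `Ext¹` of the syzygy `ker π` is `Ext²` of `M`; the syzygy sequence `P₂ → P₁ → ker π` presents
  -- the former as a quotient of the maps out of `P₂`.
  have hb := hS.extClass_precomp_bijective k (of Λ Y) 0 2 rfl
  refine ⟨hS.extClass.precompOfLinear k (of Λ Y) (by rfl : 1 + (0 + 1) = 2) ∘ₗ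
    hT.connecting k (of Λ Y) ∘ₗ (homEquivExt (Λ := Λ) k P₂ Y).toLinearMap, ?_, ?_⟩
  · exact hb.2.comp ((hT.connecting_surjective k _).comp (homEquivExt (Λ := Λ) k P₂ Y).surjective)
  · intro f
    refine (map_eq_zero_iff _ hb.1).trans ((hT.connecting_mk₀_eq_zero_iff k (of Λ Y) _).trans ?_)
    constructor
    · rintro ⟨g, hg⟩
      exact ⟨g.hom, congrArg ModuleCat.Hom.hom hg⟩
    · rintro ⟨g, rfl⟩
      exact ⟨ofHom g, rfl⟩

/-- The vanishing of extension groups beyond the length of a resolution. -/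
lemma subsingleton_ext [Module.Projective Λ P₂] (hπ : Function.Surjective π)
    (h₁ : Function.Exact d₁ π) (h₂ : Function.Exact d₂ d₁) (hd : Function.Injective d₂)
    (n : ℕ) (hn : 3 ≤ n) : Subsingleton (Ext.{u} (of Λ M) (of Λ Y) n) := by
  have hS := kernelComplex_shortExact hπ
  have hT := syzygyComplex_shortExact h₁ h₂ hd
  have : Projective (kernelComplex π).X₂ := (IsProjective.iff_projective P₀).1 inferInstance
  have : Projective (syzygyComplex h₁ h₂).X₂ := (IsProjective.iff_projective P₁).1 inferInstance
  have : Projective (syzygyComplex h₁ h₂).X₁ := (IsProjective.iff_projective P₂).1 inferInstance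
  obtain ⟨n, rfl⟩ := Nat.exists_eq_add_of_le' hn
  -- Two shifts lead from degree `n + 1` of the projective `P₂`, through degree `n + 2` of `ker π`,
  -- to degree `n + 3` of `M`.
  have b₁ := hS.extClass_precomp_bijective ℤ (of Λ Y) (n + 1) (n + 3) (by omega)
  have b₂ := hT.extClass_precomp_bijective ℤ (of Λ Y) n (n + 2) (by omega)
  have := Ext.subsingleton_of_projective (syzygyComplex h₁ h₂).X₁ (of Λ Y) n
  exact (b₁.2.comp b₂.2).subsingleton

end ModuleCat

end ExtOfResolution

/-! ### Projective modules given by families of idempotents -/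

section IdemModule

variable {Λ : Type*} [Ring Λ] {ι : Type*} (ε : ι → Λ)

/-- The direct sum of the left ideals `Λ * ε i`, as a submodule of a free module. -/
def idemSubmodule : Submodule Λ (ι → Λ) where
  carrier := {u | ∀ i, u i * ε i = u i}
  zero_mem' := by simp
  add_mem' hu hv i := by simp [add_mul, hu i, hv i]
  smul_mem' c u hu i := by simp [mul_assoc, hu i]

/-- The direct sum of the left ideals `Λ * ε i`, for idempotents `ε i`. -/
def IdemModule : Type _ := idemSubmodule ε

instance : AddCommGroup (IdemModule ε) := inferInstanceAs (AddCommGroup (idemSubmodule ε))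

instance : Module Λ (IdemModule ε) := inferInstanceAs (Module Λ (idemSubmodule ε))

namespace IdemModule

variable {ε}

/-- The coefficients of an element. -/
def coeff : IdemModule ε →ₗ[Λ] ι → Λ := (idemSubmodule ε).subtype

lemma coeff_mul (u : IdemModule ε) (i : ι) : coeff u i * ε i = coeff u i := u.2 i

@[ext] lemma ext {u v : IdemModule ε} (h : ∀ i, coeff u i = coeff v i) : u = v :=
  Subtype.ext (funext h)

/-- An element with given coefficients. -/
def mk (u : ι → Λ) (h : ∀ i, u i * ε i = u i) : IdemModule ε := ⟨u, h⟩

@[simp] lemma coeff_mk (u : ι → Λ) (h : ∀ i, u i * ε i = u i) : coeff (mk u h) = u := rfl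

/-- Right multiplication by `ε i` in each coordinate exhibits the module as a direct summand of a
free one. -/
lemma projective [Finite ι] (hε : ∀ i, ε i * ε i = ε i) : Module.Projective Λ (IdemModule ε) := by
  refine Module.Projective.of_split (M := ι → Λ) coeff
    { toFun := fun u ↦ mk (fun i ↦ u i * ε i) (fun i ↦ by rw [mul_assoc, hε])
      map_add' := fun u v ↦ by ext i; simp [add_mul]
      map_smul' := fun c u ↦ by ext i; simp [mul_assoc] } ?_
  ext u i
  exact coeff_mul u i

variable (hε : ∀ i, ε i * ε i = ε i) {M : Type*} [AddCommGroup M] [Module Λ M]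

section

variable [DecidableEq ι]

/-- The generators. -/
def gen (hε : ∀ i, ε i * ε i = ε i) (i : ι) : IdemModule ε :=
  mk (Pi.single i (ε i)) fun j ↦ by
    by_cases h : j = i
    · subst h; simp [hε]
    · simp [h]

lemma coeff_gen (i : ι) : coeff (gen hε i) = Pi.single i (ε i) := rfl

lemma smul_gen (i : ι) : ε i • gen hε i = gen hε i := by
  ext j
  rw [map_smul, coeff_gen, ← Pi.single_smul, smul_eq_mul, hε]

lemma smul_map_gen (f : IdemModule ε →ₗ[Λ] M) (i : ι) : ε i • f (gen hε i) = f (gen hε i) := by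
  rw [← map_smul, smul_gen]

end

variable [Fintype ι]

variable (ε) in
/-- The linear map that sends the generators to given elements. -/
def lift (m : ι → M) : IdemModule ε →ₗ[Λ] M where
  toFun u := ∑ i, coeff u i • m i
  map_add' u v := by simp [add_smul, Finset.sum_add_distrib]
  map_smul' c u := by simp [mul_smul, Finset.smul_sum]

lemma lift_apply (m : ι → M) (u : IdemModule ε) : lift ε m u = ∑ i, coeff u i • m i := rfl

variable [DecidableEq ι]

lemma lift_gen (m : ι → M) (i : ι) : lift ε m (gen hε i) = ε i • m i := by
  rw [lift_apply, Finset.sum_eq_single i _ (by simp)]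
  · simp [coeff_gen]
  · intro j _ h
    simp [coeff_gen, h]

lemma eq_sum (u : IdemModule ε) : u = ∑ i, coeff u i • gen hε i := by
  ext j
  simp only [map_sum, map_smul, Finset.sum_apply, coeff_gen, Pi.smul_apply]
  rw [Finset.sum_eq_single j _ (by simp)]
  · simp [coeff_mul]
  · intro i _ h
    simp [h.symm]

lemma map_eq_sum (f : IdemModule ε →ₗ[Λ] M) (u : IdemModule ε) :
    f u = ∑ i, coeff u i • f (gen hε i) := by
  conv_lhs => rw [eq_sum hε u]
  simp

lemma hom_ext {f g : IdemModule ε →ₗ[Λ] M} (h : ∀ i, f (gen hε i) = g (gen hε i)) : f = g := by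
  ext u
  rw [map_eq_sum hε, map_eq_sum hε g]
  simp [h]

end IdemModule

end IdemModule

/-! ### The enveloping algebra and its action on bimodules -/

section Bimodule

open MulOpposite

/-- The enveloping algebra `A ⊗ Aᵐᵒᵖ`. -/
def Env (k A : Type*) [Field k] [Ring A] [Algebra k A] := A ⊗[k] Aᵐᵒᵖ

variable {k A : Type*} [Field k] [Ring A] [Algebra k A]

instance : Ring (Env k A) := inferInstanceAs (Ring (A ⊗[k] Aᵐᵒᵖ))

instance : Algebra k (Env k A) := inferInstanceAs (Algebra k (A ⊗[k] Aᵐᵒᵖ))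

variable (k) in
/-- The element `a ⊗ b` of the enveloping algebra. -/
def ten (a b : A) : Env k A := (a ⊗ₜ op b : A ⊗[k] Aᵐᵒᵖ)

variable (k A) in
/-- The left factor of the enveloping algebra. -/
def envLeft : A →+* Env k A :=
  (Algebra.TensorProduct.includeLeft : A →ₐ[k] A ⊗[k] Aᵐᵒᵖ).toRingHom

variable (k A) in
/-- The right factor of the enveloping algebra. -/
def envRight : Aᵐᵒᵖ →+* Env k A :=
  (Algebra.TensorProduct.includeRight : Aᵐᵒᵖ →ₐ[k] A ⊗[k] Aᵐᵒᵖ).toRingHom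

lemma ten_mul_ten (a b c d : A) : ten k a b * ten k c d = ten k (a * c) (d * b) :=
  Algebra.TensorProduct.tmul_mul_tmul a c (op b) (op d)

lemma ten_induction {p : Env k A → Prop} (x : Env k A) (zero : p 0)
    (ten : ∀ a b, p (ten k a b)) (add : ∀ x y, p x → p y → p (x + y)) : p x :=
  TensorProduct.induction_on (motive := p) x zero (fun a b ↦ ten a (unop b)) add

lemma ten_add_left (a b c : A) : ten k (a + b) c = ten k a c + ten k b c :=
  TensorProduct.add_tmul a b (op c)

lemma ten_add_right (a b c : A) : ten k a (b + c) = ten k a b + ten k a c :=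
  TensorProduct.tmul_add a (op b) (op c)

lemma ten_smul_left (r : k) (a b : A) : ten k (r • a) b = r • ten k a b :=
  (TensorProduct.smul_tmul' r a (op b)).symm

lemma ten_smul_right (r : k) (a b : A) : ten k a (r • b) = r • ten k a b :=
  TensorProduct.tmul_smul r a (op b)

@[simp] lemma ten_zero_left (a : A) : ten k 0 a = 0 := by
  simpa using ten_smul_left (0 : k) 0 a

@[simp] lemma ten_zero_right (a : A) : ten k a 0 = 0 := by
  simpa using ten_smul_right (0 : k) a 0

/-- Linear maps out of the enveloping algebra are bilinear maps. -/
lemma exists_env_lift {Q : Type*} [AddCommGroup Q] [Module k Q] (B : A →ₗ[k] A →ₗ[k] Q) :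
    ∃ T : Env k A →ₗ[k] Q, ∀ a b, T (ten k a b) = B a b :=
  ⟨(TensorProduct.lift (B.compl₂ (opLinearEquiv k).symm.toLinearMap) : A ⊗[k] Aᵐᵒᵖ →ₗ[k] Q),
    fun _ _ ↦ rfl⟩

/-- Right multiplication by `1 ⊗ z` is injective for a regular element `z`. -/
lemma eq_zero_of_mul_ten_one {z : A} (hz : ∀ a, z * a = 0 → a = 0) {x : Env k A}
    (h : x * ten k 1 z = 0) : x = 0 := by
  let f : Aᵐᵒᵖ →ₗ[k] Aᵐᵒᵖ := LinearMap.mulRight k (op z)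
  have hf : Function.Injective f := by
    rw [injective_iff_map_eq_zero]
    intro a ha
    exact unop_injective (hz _ (congrArg unop ha))
  -- Over a field, tensoring with `A` keeps multiplication by `z` on the second factor injective.
  have hinj := Module.Flat.lTensor_preserves_injective_linearMap (M := A) f hf
  have key : ∀ y : Env k A, y * ten k 1 z = f.lTensor A y := by
    intro y
    induction y using ten_induction with
    | zero => rw [zero_mul]; exact (map_zero (f.lTensor A)).symm
    | ten a b => rw [ten_mul_ten, mul_one]; rfl
    | add x y hx hy => rw [add_mul, hx, hy]; exact (map_add (f.lTensor A) x y).symm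
  rw [key] at h
  exact hinj (h.trans (map_zero (f.lTensor A)).symm)

variable {M : Type*} [AddCommGroup M] [Module (Env k A) M]

lemma ten_smul_ten_smul (a b c d : A) (m : M) :
    ten k a b • ten k c d • m = ten k (a * c) (d * b) • m := by
  rw [← mul_smul, ten_mul_ten]

/-- The diagonal bimodule structure. -/
instance diagonalModule : Module (Env k A) A :=
  (TensorProduct.Algebra.module : Module (A ⊗[k] Aᵐᵒᵖ) A)

lemma ten_smul (a b x : A) : ten k a b • x = a * x * b := by
  rw [mul_assoc]
  exact (TensorProduct.Algebra.smul_def a (op b) x)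

instance : IsScalarTower k (Env k A) A := by
  refine ⟨fun c x a ↦ ?_⟩
  induction x using ten_induction with
  | zero => simp
  | ten x y => rw [← ten_smul_left, ten_smul, ten_smul]; simp
  | add x y hx hy => rw [smul_add, add_smul, hx, hy, add_smul, smul_add]

end Bimodule

/-! ### Derivations as sections of the trivial square-zero extension -/

namespace KLRW

variable {k : Type u} [Field k] {N : ℕ}

section derivation

variable {Q : Type*} [AddCommGroup Q] [Module (Env k (PathAlg k N)) Q] [Module k Q]
  [IsScalarTower k (Env k (PathAlg k N)) Q]

/-- Derivations into a bimodule are determined by their values on the generators. -/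
lemma exists_derivation (dp dq : Fin N → Q) (ds : Fin (N + 1) → Q)
    (hes : ∀ i, ten k (idem k i) 1 • ds i = ds i) (hse : ∀ i, ten k 1 (idem k i) • ds i = ds i)
    (hep : ∀ i : Fin N, ten k (idem k i.succ) 1 • dp i = dp i)
    (hpe : ∀ i : Fin N, ten k 1 (idem k i.castSucc) • dp i = dp i)
    (heq : ∀ i : Fin N, ten k (idem k i.castSucc) 1 • dq i = dq i)
    (hqe : ∀ i : Fin N, ten k 1 (idem k i.succ) • dq i = dq i)
    (hqp : ∀ i : Fin N, ten k (down k i) 1 • dp i + ten k 1 (up k i) • dq i = ds i.castSucc)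
    (hpq : ∀ i : Fin N, ten k (up k i) 1 • dq i + ten k 1 (down k i) • dp i = ds i.succ) :
    ∃ D : PathAlg k N →ₗ[k] Q, (∀ a b, D (a * b) = ten k a 1 • D b + ten k 1 b • D a) ∧
      (∀ i, D (idem k i) = 0) ∧ (∀ i, D (loop k i) = ds i) ∧ (∀ i, D (up k i) = dp i) ∧
      ∀ i, D (down k i) = dq i := by
  let : Module (PathAlg k N) Q := Module.compHom Q (envLeft k (PathAlg k N))
  let : Module (PathAlg k N)ᵐᵒᵖ Q := Module.compHom Q (envRight k (PathAlg k N))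
  have hl : ∀ (a : PathAlg k N) (m : Q), a • m = ten k a 1 • m := fun _ _ ↦ rfl
  have hr : ∀ (a : PathAlg k N) (m : Q), MulOpposite.op a • m = ten k 1 a • m := fun _ _ ↦ rfl
  have : SMulCommClass (PathAlg k N) (PathAlg k N)ᵐᵒᵖ Q := ⟨fun a b m ↦ by
    induction b using MulOpposite.rec' with | _ b
    rw [hl, hr, hr, hl, ten_smul_ten_smul, ten_smul_ten_smul]; simp⟩
  have : IsScalarTower k (PathAlg k N) Q := ⟨fun c a m ↦ by
    rw [hl, hl, ten_smul_left, smul_assoc]⟩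
  have : IsScalarTower k (PathAlg k N)ᵐᵒᵖ Q := ⟨fun c a m ↦ by
    induction a using MulOpposite.rec' with | _ a
    rw [← MulOpposite.op_smul, hr, hr, ten_smul_right, smul_assoc]⟩
  -- A derivation `D` is the second component of an algebra map `a ↦ (a, D a)` into the square-zero
  -- extension. The hypotheses say that the prescribed images of the generators satisfy the defining
  -- relations there.
  let t (a : PathAlg k N) (m : Q) : TrivSqZeroExt (PathAlg k N) Q := (a, m)
  have ht : ∀ a m b n, t a m * t b n = t (a * b) (ten k a 1 • n + ten k 1 b • m) :=
    fun _ _ _ _ ↦ rfl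
  obtain ⟨φ, h1, h2, h3, h4⟩ := exists_lift (k := k) (N := N)
    (fun i ↦ t (idem k i) 0) (fun i ↦ t (loop k i) (ds i)) (fun i ↦ t (up k i) (dp i))
    (fun i ↦ t (down k i) (dq i)) (fun i ↦ by simp [ht]) (fun i j h ↦ by
      rw [ht, idem_mul_ne k h]; simp; rfl) (by
      refine TrivSqZeroExt.ext ?_ ?_
      · exact (TrivSqZeroExt.fst_sum _ _).trans (sum_idem k)
      · exact (TrivSqZeroExt.snd_sum _ _).trans Finset.sum_const_zero) (fun i ↦ by simp [ht, hes])
    (fun i ↦ by simp [ht, hse]) (fun i ↦ by simp [ht, hep]) (fun i ↦ by simp [ht, hpe])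
    (fun i ↦ by simp [ht, heq]) (fun i ↦ by simp [ht, hqe]) (fun i ↦ by simp [ht, hqp])
    (fun i ↦ by simp [ht, hpq])
  have hfst : ∀ a, (φ a).fst = a := by
    let S := AlgHom.equalizer ((TrivSqZeroExt.fstHom k (PathAlg k N) Q).comp φ) (AlgHom.id k _)
    exact mem_of_generators_mem S (fun i ↦ congrArg TrivSqZeroExt.fst (h1 i))
      (fun i ↦ congrArg TrivSqZeroExt.fst (h2 i)) (fun i ↦ congrArg TrivSqZeroExt.fst (h3 i))
      (fun i ↦ congrArg TrivSqZeroExt.fst (h4 i))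
  refine ⟨TrivSqZeroExt.sndHom (PathAlg k N) Q |>.restrictScalars k |>.comp φ.toLinearMap,
    ?_, ?_, ?_, ?_, ?_⟩
  · intro a b
    change (φ (a * b)).snd = ten k a 1 • (φ b).snd + ten k 1 b • (φ a).snd
    rw [map_mul, TrivSqZeroExt.snd_mul, hfst, hfst, hl, hr]
  · exact fun i ↦ congrArg TrivSqZeroExt.snd (h1 i)
  · exact fun i ↦ congrArg TrivSqZeroExt.snd (h2 i)
  · exact fun i ↦ congrArg TrivSqZeroExt.snd (h3 i)
  · exact fun i ↦ congrArg TrivSqZeroExt.snd (h4 i)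

end derivation

end KLRW

/-! ### The bimodule resolution and its exactness -/

namespace KLRW

variable (k : Type u) [Field k] (N : ℕ)

/-- The arrows that generate the algebra over the trivial paths: the loop at the vertex `0`, the
arrows `i ⟶ i + 1` and the arrows `i + 1 ⟶ i`. -/
abbrev Arrow : Type := Option (Fin N ⊕ Fin N)

variable {N}

/-- The source of an arrow. -/
def src : Arrow N → Fin (N + 1)
  | none => 0
  | some (.inl i) => i.castSucc
  | some (.inr i) => i.succ

/-- The target of an arrow. -/
def tgt : Arrow N → Fin (N + 1)
  | none => 0
  | some (.inl i) => i.succ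
  | some (.inr i) => i.castSucc

/-- The element of the algebra given by an arrow. -/
def arr : Arrow N → PathAlg k N
  | none => loop k 0
  | some (.inl i) => up k i
  | some (.inr i) => down k i

@[simp] lemma idem_tgt_mul_arr (α : Arrow N) : idem k (tgt α) * arr k α = arr k α := by
  rcases α with _ | i | i <;> simp [tgt, arr]

@[simp] lemma arr_mul_idem_src (α : Arrow N) : arr k α * idem k (src α) = arr k α := by
  rcases α with _ | i | i <;> simp [src, arr]

/-- The idempotent of a pair of vertices. -/
def pairIdem (i j : Fin (N + 1)) : Env k (PathAlg k N) := ten k (idem k i) (idem k j)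

lemma pairIdem_mul_self (i j : Fin (N + 1)) :
    pairIdem k i j * pairIdem k i j = pairIdem k i j := by
  simp [pairIdem, ten_mul_ten]

variable (N)

/-- Degree zero of the resolution, with one generator for each vertex. -/
abbrev Res₀ := IdemModule (fun i : Fin (N + 1) ↦ pairIdem k i i)

/-- Degree one of the resolution, with one generator for each arrow. -/
abbrev Res₁ := IdemModule (fun α : Arrow N ↦ pairIdem k (tgt α) (src α))

/-- Degree two of the resolution, with one generator for each relation `q p = s`. -/
abbrev Res₂ := IdemModule (fun i : Fin N ↦ pairIdem k i.castSucc i.castSucc)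

variable {N}

/-- The generators in degree zero. -/
def gen₀ (i : Fin (N + 1)) : Res₀ k N := IdemModule.gen (fun _ ↦ pairIdem_mul_self ..) i

/-- The generators in degree one. -/
def gen₁ (α : Arrow N) : Res₁ k N := IdemModule.gen (fun _ ↦ pairIdem_mul_self ..) α

/-- The generators in degree two. -/
def gen₂ (i : Fin N) : Res₂ k N := IdemModule.gen (fun _ ↦ pairIdem_mul_self ..) i

instance : Module.Projective (Env k (PathAlg k N)) (Res₀ k N) :=
  IdemModule.projective fun _ ↦ pairIdem_mul_self ..

instance : Module.Projective (Env k (PathAlg k N)) (Res₁ k N) :=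
  IdemModule.projective fun _ ↦ pairIdem_mul_self ..

instance : Module.Projective (Env k (PathAlg k N)) (Res₂ k N) :=
  IdemModule.projective fun _ ↦ pairIdem_mul_self ..

section pairIdem

variable {k} {M : Type*} [AddCommGroup M] [Module (Env k (PathAlg k N)) M] {i j : Fin (N + 1)}
  {m : M}

lemma idem_left_smul (h : pairIdem k i j • m = m) : ten k (idem k i) 1 • m = m := by
  rw [← h, pairIdem, ten_smul_ten_smul]; simp

lemma idem_right_smul (h : pairIdem k i j • m = m) : ten k 1 (idem k j) • m = m := by
  rw [← h, pairIdem, ten_smul_ten_smul]; simp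

end pairIdem

lemma pairIdem_smul_gen₀ (i : Fin (N + 1)) : pairIdem k i i • gen₀ k i = gen₀ k i :=
  IdemModule.smul_gen (ε := fun i : Fin (N + 1) ↦ pairIdem k i i) _ i

lemma pairIdem_smul_gen₁ (α : Arrow N) : pairIdem k (tgt α) (src α) • gen₁ k α = gen₁ k α :=
  IdemModule.smul_gen (ε := fun α : Arrow N ↦ pairIdem k (tgt α) (src α)) _ α

variable (N) in
/-- The augmentation. -/
def augmentation : Res₀ k N →ₗ[Env k (PathAlg k N)] PathAlg k N :=
  IdemModule.lift _ fun i ↦ idem k i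

lemma augmentation_gen₀ (i : Fin (N + 1)) : augmentation k N (gen₀ k i) = idem k i := by
  rw [augmentation, gen₀, IdemModule.lift_gen, pairIdem, ten_smul]; simp

variable (N) in
/-- The first differential. -/
def diff₁ : Res₁ k N →ₗ[Env k (PathAlg k N)] Res₀ k N := IdemModule.lift _ fun α ↦
  ten k (arr k α) 1 • gen₀ k (src α) - ten k 1 (arr k α) • gen₀ k (tgt α)

lemma diff₁_gen₁ (α : Arrow N) : diff₁ k N (gen₁ k α) =
    ten k (arr k α) 1 • gen₀ k (src α) - ten k 1 (arr k α) • gen₀ k (tgt α) := by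
  rw [diff₁, gen₁, IdemModule.lift_gen, pairIdem, smul_sub, ten_smul_ten_smul, ten_smul_ten_smul,
    ← idem_right_smul (pairIdem_smul_gen₀ k (src α)),
    ← idem_left_smul (pairIdem_smul_gen₀ k (tgt α))]
  simp [ten_smul_ten_smul]

/-- The universal derivation of the loop at a vertex. -/
def loopDeriv : Fin (N + 1) → Res₁ k N :=
  Fin.cases (gen₁ k none) fun j ↦
    ten k (up k j) 1 • gen₁ k (some (.inr j)) + ten k 1 (down k j) • gen₁ k (some (.inl j))

lemma idem_loopDeriv (i : Fin (N + 1)) :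
    ten k (idem k i) 1 • loopDeriv k i = loopDeriv k i ∧
      ten k 1 (idem k i) • loopDeriv k i = loopDeriv k i := by
  cases i using Fin.cases with
  | zero => exact ⟨idem_left_smul (pairIdem_smul_gen₁ k none),
      idem_right_smul (pairIdem_smul_gen₁ k none)⟩
  | succ j =>
    have h1 := idem_right_smul (pairIdem_smul_gen₁ k (some (.inr j)))
    have h2 := idem_left_smul (pairIdem_smul_gen₁ k (some (.inl j)))
    simp only [src, tgt] at h1 h2
    constructor
    · simp only [loopDeriv, Fin.cases_succ, smul_add, ten_smul_ten_smul, idem_mul_up, mul_one]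
      congr 1
      nth_rw 2 [← h2]
      simp only [ten_smul_ten_smul, one_mul]
    · simp only [loopDeriv, Fin.cases_succ, smul_add, ten_smul_ten_smul, down_mul_idem, mul_one,
        one_mul]
      congr 1
      nth_rw 2 [← h1]
      simp only [ten_smul_ten_smul, mul_one]

variable (N) in
/-- The second differential. -/
def diff₂ : Res₂ k N →ₗ[Env k (PathAlg k N)] Res₁ k N := IdemModule.lift _ fun i ↦
  ten k (down k i) 1 • gen₁ k (some (.inl i)) + ten k 1 (up k i) • gen₁ k (some (.inr i)) -
    loopDeriv k i.castSucc

lemma diff₂_gen₂ (i : Fin N) : diff₂ k N (gen₂ k i) =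
    ten k (down k i) 1 • gen₁ k (some (.inl i)) + ten k 1 (up k i) • gen₁ k (some (.inr i)) -
      loopDeriv k i.castSucc := by
  have h1 := idem_right_smul (pairIdem_smul_gen₁ k (some (.inl i)))
  have h2 := idem_left_smul (pairIdem_smul_gen₁ k (some (.inr i)))
  have h3 := idem_loopDeriv k i.castSucc
  simp only [src, tgt] at h1 h2
  have h4 : pairIdem k i.castSucc i.castSucc • loopDeriv k i.castSucc = loopDeriv k i.castSucc := by
    conv_rhs => rw [← h3.1, ← h3.2]
    simp only [pairIdem, ten_smul_ten_smul, mul_one]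
  rw [diff₂, gen₂, IdemModule.lift_gen, smul_sub, smul_add, h4, pairIdem, ten_smul_ten_smul,
    ten_smul_ten_smul]
  congr 2
  · nth_rw 2 [← h1]
    simp only [ten_smul_ten_smul, idem_mul_down, one_mul, mul_one]
  · nth_rw 2 [← h2]
    rw [ten_smul_ten_smul]
    simp

lemma augmentation_surjective : Function.Surjective (augmentation k N) := by
  intro a
  refine ⟨∑ i, ten k a 1 • gen₀ k i, ?_⟩
  simp only [map_sum, map_smul, augmentation_gen₀, ten_smul, mul_one]
  rw [← Finset.mul_sum, sum_idem, mul_one]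

lemma augmentation_diff₁ (u : Res₁ k N) : augmentation k N (diff₁ k N u) = 0 := by
  have : augmentation k N ∘ₗ diff₁ k N = 0 := by
    refine IdemModule.hom_ext (fun _ ↦ pairIdem_mul_self ..) fun α ↦ ?_
    change augmentation k N (diff₁ k N (gen₁ k α)) = 0
    rw [diff₁_gen₁]
    simp [augmentation_gen₀, ten_smul]
  exact LinearMap.congr_fun this u

lemma idem_smul_sum_gen₀ (i : Fin (N + 1)) :
    ten k (idem k i) 1 • ∑ j, gen₀ k j = gen₀ k i ∧
      ten k 1 (idem k i) • ∑ j, gen₀ k j = gen₀ k i := by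
  constructor
  · rw [Finset.smul_sum, Finset.sum_eq_single i _ (by simp),
      idem_left_smul (pairIdem_smul_gen₀ k i)]
    intro j _ h
    rw [← idem_left_smul (pairIdem_smul_gen₀ k j), ten_smul_ten_smul, idem_mul_ne k h.symm]
    simp
  · rw [Finset.smul_sum, Finset.sum_eq_single i _ (by simp),
      idem_right_smul (pairIdem_smul_gen₀ k i)]
    intro j _ h
    rw [← idem_right_smul (pairIdem_smul_gen₀ k j), ten_smul_ten_smul, idem_mul_ne k h]
    simp

/-- The sum of the generators is central modulo the image of the first differential. -/
lemma sum_gen₀_central (a : PathAlg k N) :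
    ten k a 1 • ∑ j, gen₀ k j - ten k 1 a • ∑ j, gen₀ k j ∈ LinearMap.range (diff₁ k N) := by
  set c := ∑ j, gen₀ k j with hc
  let S : Subalgebra k (PathAlg k N) :=
    { carrier := {a | ten k a 1 • c - ten k 1 a • c ∈ LinearMap.range (diff₁ k N)}
      mul_mem' := fun {x y} hx hy ↦ by
        -- Leibniz rule for commutators: `xy c - c xy = x (y c - c y) + (x c - c x) y`.
        have h1 := Submodule.smul_mem (LinearMap.range (diff₁ k N)) (ten k x 1) hy
        have h2 := Submodule.smul_mem (LinearMap.range (diff₁ k N)) (ten k 1 y) hx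
        have := Submodule.add_mem _ h1 h2
        simp only [smul_sub, ten_smul_ten_smul, mul_one, one_mul] at this
        simpa using this
      add_mem' := fun {x y} hx hy ↦ by
        have := Submodule.add_mem (LinearMap.range (diff₁ k N)) hx hy
        simp only [Set.mem_ofPred_eq, ten_add_left, ten_add_right, add_smul]
        rwa [add_sub_add_comm]
      algebraMap_mem' := fun r ↦ by
        rw [Set.mem_ofPred_eq, Algebra.algebraMap_eq_smul_one, ten_smul_left, ten_smul_right,
          sub_self]
        exact Submodule.zero_mem _ }
  have harr : ∀ α : Arrow N, arr k α ∈ S := by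
    intro α
    refine ⟨gen₁ k α, ?_⟩
    rw [diff₁_gen₁, ← (idem_smul_sum_gen₀ k (src α)).1, ← (idem_smul_sum_gen₀ k (tgt α)).2,
      ten_smul_ten_smul, ten_smul_ten_smul]
    simp [hc]
  refine mem_of_generators_mem S ?_ ?_ (fun i ↦ harr (some (.inl i)))
    (fun i ↦ harr (some (.inr i))) a
  · intro i
    change ten k (idem k i) 1 • c - ten k 1 (idem k i) • c ∈ LinearMap.range (diff₁ k N)
    rw [hc, (idem_smul_sum_gen₀ k i).1, (idem_smul_sum_gen₀ k i).2, sub_self]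
    exact Submodule.zero_mem _
  · intro i
    cases i using Fin.cases with
    | zero => exact harr none
    | succ j =>
      rw [← up_mul_down]
      exact S.mul_mem (harr (some (.inl j))) (harr (some (.inr j)))

/-- Modulo boundaries the left factor moves across the central sum of generators, so only the
augmentation of an element, placed on the right, survives. -/
lemma smul_gen₀_sub_mem (x : Env k (PathAlg k N)) (i : Fin (N + 1)) :
    x • gen₀ k i - ten k 1 (x • idem k i) • ∑ j, gen₀ k j ∈ LinearMap.range (diff₁ k N) := by
  induction x using ten_induction with
  | zero => simp
  | ten a b =>
    have := Submodule.smul_mem _ (ten k 1 b) (sum_gen₀_central k (a * idem k i))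
    rw [smul_sub, ten_smul_ten_smul, ten_smul_ten_smul] at this
    rw [ten_smul, ← (idem_smul_sum_gen₀ k i).1, ten_smul_ten_smul]
    simpa using this
  | add x y hx hy =>
    have := Submodule.add_mem _ hx hy
    rwa [add_smul, add_smul, ten_add_right, add_smul, add_sub_add_comm]

/-- Summing `smul_gen₀_sub_mem` over the vertices, `u` is congruent to its augmentation acting on
the right of the sum of generators, hence is a boundary when the augmentation is zero. -/
lemma exact_diff₁_augmentation : Function.Exact (diff₁ k N) (augmentation k N) := by
  intro u
  refine ⟨fun h ↦ ?_, ?_⟩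
  · have h1 := Submodule.sum_mem (LinearMap.range (diff₁ k N)) (t := Finset.univ)
      (f := fun i ↦ IdemModule.coeff u i • gen₀ k i -
        ten k 1 (IdemModule.coeff u i • idem k i) • ∑ j, gen₀ k j)
      fun i _ ↦ smul_gen₀_sub_mem k _ i
    have h2 : ∑ i, ten k 1 (IdemModule.coeff u i • idem k i) =
        ten k 1 (∑ i, IdemModule.coeff u i • idem k i) :=
      (map_sum (AddMonoidHom.mk' (fun b ↦ ten k (1 : PathAlg k N) b) (ten_add_right 1)) _ _).symm
    rw [Finset.sum_sub_distrib, ← Finset.sum_smul, h2] at h1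
    have h3 : ∑ i, IdemModule.coeff u i • gen₀ k i = u :=
      (IdemModule.eq_sum (fun _ ↦ pairIdem_mul_self ..) u).symm
    have h4 : ∑ i, IdemModule.coeff u i • idem k i = 0 := h
    rw [h3, h4, ten_zero_right, zero_smul, sub_zero] at h1
    exact h1
  · rintro ⟨v, rfl⟩
    exact augmentation_diff₁ k v

/-- Applied to the formal derivative of a path `w`, `diff₁` telescopes to `w ⊗ 1 - 1 ⊗ w`; these
agree for `q p` and `s`. -/
lemma diff₁_diff₂ (u : Res₂ k N) : diff₁ k N (diff₂ k N u) = 0 := by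
  have hl : ∀ i : Fin (N + 1), diff₁ k N (loopDeriv k i) =
      ten k (loop k i) 1 • gen₀ k i - ten k 1 (loop k i) • gen₀ k i := by
    intro i
    cases i using Fin.cases with
    | zero => exact diff₁_gen₁ k none
    | succ j =>
      simp only [loopDeriv, Fin.cases_succ, map_add, map_smul, diff₁_gen₁, smul_sub,
        ten_smul_ten_smul, arr, src, tgt, mul_one, one_mul, up_mul_down]
      abel
  have : diff₁ k N ∘ₗ diff₂ k N = 0 := by
    refine IdemModule.hom_ext (fun _ ↦ pairIdem_mul_self ..) fun i ↦ ?_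
    change diff₁ k N (diff₂ k N (gen₂ k i)) = 0
    rw [diff₂_gen₂, map_sub, hl]
    simp only [map_add, map_smul, diff₁_gen₁, smul_sub,
        ten_smul_ten_smul, arr, src, tgt, mul_one, one_mul, down_mul_up]
    abel
  exact LinearMap.congr_fun this u

section retraction

variable {k} {Q : Type*} [AddCommGroup Q] [Module (Env k (PathAlg k N)) Q] [Module k Q]
  [IsScalarTower k (Env k (PathAlg k N)) Q]

/-- A linear map on degree one that comes from a derivation vanishes on cycles. -/
lemma map_eq_zero_of_diff₁_eq_zero (D : PathAlg k N →ₗ[k] Q)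
    (hD : ∀ a b, D (a * b) = ten k a 1 • D b + ten k 1 b • D a) (hDe : ∀ i, D (idem k i) = 0)
    (f : Res₁ k N →ₗ[Env k (PathAlg k N)] Q) (hf : ∀ α, D (arr k α) = f (gen₁ k α))
    (u : Res₁ k N) (h : diff₁ k N u = 0) : f u = 0 := by
  obtain ⟨T, hT⟩ := exists_env_lift (k := k) (A := PathAlg k N) (Q := Q)
    (LinearMap.mk₂ k (fun a b ↦ ten k 1 b • D a) (fun a b c ↦ by rw [map_add, smul_add])
      (fun r a b ↦ by rw [map_smul, smul_comm]) (fun a b c ↦ by rw [ten_add_right, add_smul])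
      (fun r a b ↦ by rw [ten_smul_right, smul_assoc]))
  have hT' : ∀ a b, T (ten k a b) = ten k 1 b • D a := hT
  -- `τ` sends `a ⊗ b` to `D(a) b`. It is only additive, yet `τ ∘ diff₁ = f`: by Leibniz, `D(a α) b
  -- - D(a) α b = a D(α) b`.
  let τ : Res₀ k N →+ Q := AddMonoidHom.mk' (fun v ↦ ∑ i, T (IdemModule.coeff v i))
    fun v w ↦ by simp [Finset.sum_add_distrib]
  have hτgen : ∀ a b i, τ (ten k a b • gen₀ k i) = ten k 1 (idem k i * b) • D (a * idem k i) := by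
    intro a b i
    change ∑ j, T (IdemModule.coeff (ten k a b • gen₀ k i) j) = _
    simp only [map_smul, gen₀, IdemModule.coeff_gen, Pi.smul_apply, smul_eq_mul]
    rw [Finset.sum_eq_single i _ (by simp)]
    · rw [Pi.single_eq_same, pairIdem, ten_mul_ten, hT']
    · intro j _ h
      simp [h]
  have key : ∀ (x : Env k (PathAlg k N)) α, τ (x • diff₁ k N (gen₁ k α)) = x • f (gen₁ k α) := by
    intro x α
    induction x using ten_induction with
    | zero => simp
    | add x y hx hy => rw [add_smul, map_add, hx, hy, add_smul]
    | ten a b =>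
      have h1 : D (a * idem k (tgt α)) = ten k 1 (idem k (tgt α)) • D a := by
        rw [hD, hDe, smul_zero, zero_add]
      have h2 : ten k 1 (idem k (src α)) • f (gen₁ k α) = f (gen₁ k α) := by
        rw [← map_smul, idem_right_smul (pairIdem_smul_gen₁ k α)]
      rw [diff₁_gen₁, smul_sub, ten_smul_ten_smul, ten_smul_ten_smul, map_sub, hτgen, hτgen,
        one_mul, mul_one, mul_assoc a, arr_mul_idem_src, hD, h1, smul_add, ten_smul_ten_smul,
        ten_smul_ten_smul, ten_smul_ten_smul, ← mul_assoc, ← mul_assoc, ← mul_assoc,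
        arr_mul_idem_src, idem_mul_self, ← mul_assoc (idem k _),
        idem_tgt_mul_arr, add_sub_cancel_right, hf]
      conv_rhs => rw [← h2, ten_smul_ten_smul]
      simp only [one_mul, mul_one]
  rw [IdemModule.map_eq_sum (fun _ ↦ pairIdem_mul_self ..) f u]
  rw [IdemModule.map_eq_sum (fun _ ↦ pairIdem_mul_self ..) (diff₁ k N) u] at h
  rw [← map_zero τ, ← h, map_sum]
  exact Finset.sum_congr rfl fun α _ ↦ (key _ α).symm

end retraction

/-- In the quotient `Q` of `Res₁` by the boundaries the differentiated relations hold, so the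
classes of the generators extend to a derivation. The quotient map then factors through `diff₁` and
kills cycles. -/
lemma exact_diff₂_diff₁ : Function.Exact (diff₂ k N) (diff₁ k N) := by
  intro u
  refine ⟨fun h ↦ ?_, ?_⟩
  swap
  · rintro ⟨v, rfl⟩
    exact diff₁_diff₂ k v
  obtain ⟨Q, _, _, f, hf⟩ : ∃ (Q : Type u) (_ : AddCommGroup Q)
      (_ : Module (Env k (PathAlg k N)) Q) (f : Res₁ k N →ₗ[Env k (PathAlg k N)] Q),
      ∀ v, f v = 0 ↔ v ∈ LinearMap.range (diff₂ k N) :=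
    ⟨_ ⧸ LinearMap.range (diff₂ k N), inferInstance, inferInstance, Submodule.mkQ _,
      fun v ↦ Submodule.Quotient.mk_eq_zero _⟩
  let : Module k Q := Module.compHom Q (algebraMap k (Env k (PathAlg k N)))
  have : IsScalarTower k (Env k (PathAlg k N)) Q := .of_algebraMap_smul fun _ _ ↦ rfl
  have hgl : ∀ α, ten k (idem k (tgt α)) 1 • f (gen₁ k α) = f (gen₁ k α) := fun α ↦ by
    rw [← map_smul, idem_left_smul (pairIdem_smul_gen₁ k α)]
  have hgr : ∀ α, ten k 1 (idem k (src α)) • f (gen₁ k α) = f (gen₁ k α) := fun α ↦ by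
    rw [← map_smul, idem_right_smul (pairIdem_smul_gen₁ k α)]
  obtain ⟨D, hD, hDe, hDs, hDp, hDq⟩ := exists_derivation (k := k) (N := N) (Q := Q)
    (fun i ↦ f (gen₁ k (some (.inl i)))) (fun i ↦ f (gen₁ k (some (.inr i))))
    (fun i ↦ f (loopDeriv k i))
    (fun i ↦ by rw [← map_smul, (idem_loopDeriv k i).1])
    (fun i ↦ by rw [← map_smul, (idem_loopDeriv k i).2])
    (fun i ↦ hgl (some (.inl i))) (fun i ↦ hgr (some (.inl i))) (fun i ↦ hgl (some (.inr i)))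
    (fun i ↦ hgr (some (.inr i)))
    (fun i ↦ by
      rw [← map_smul, ← map_smul, ← map_add, ← sub_eq_zero, ← map_sub, hf]
      exact ⟨gen₂ k i, diff₂_gen₂ k i⟩)
    (fun i ↦ by rw [← map_smul, ← map_smul, ← map_add]; rfl)
  have hDarr : ∀ α, D (arr k α) = f (gen₁ k α) := by
    rintro (_ | i | i)
    · exact hDs 0
    · exact hDp i
    · exact hDq i
  exact (hf u).1 (map_eq_zero_of_diff₁_eq_zero D hD hDe f hDarr u h)

end KLRW

namespace KLRW

variable (k : Type u) [Field k] {N : ℕ}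

/-! ### Injectivity of the second differential -/

section injectivity

open IdemModule

lemma coeff_gen₁ (α β : Arrow N) :
    coeff (gen₁ k α) β = if β = α then pairIdem k (tgt α) (src α) else 0 := by
  rw [gen₁, coeff_gen, Pi.single_apply]

lemma loopDeriv_zero : loopDeriv k (0 : Fin (N + 1)) = gen₁ k none := rfl

lemma loopDeriv_succ (j : Fin N) : loopDeriv k j.succ =
    ten k (up k j) 1 • gen₁ k (some (.inr j)) + ten k 1 (down k j) • gen₁ k (some (.inl j)) := rfl

lemma coeff_loopDeriv_none (i : Fin (N + 1)) :
    coeff (loopDeriv k i) none = if i = 0 then pairIdem k 0 0 else 0 := by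
  cases i using Fin.cases with
  | zero => simp only [loopDeriv_zero, coeff_gen₁, if_true]; rfl
  | succ j => simp [loopDeriv_succ, coeff_gen₁]

lemma coeff_loopDeriv_up (i : Fin (N + 1)) (j : Fin N) :
    coeff (loopDeriv k i) (some (.inl j)) =
      if i = j.succ then ten k 1 (down k j) * pairIdem k j.succ j.castSucc else 0 := by
  cases i using Fin.cases with
  | zero => simp [loopDeriv_zero, coeff_gen₁, (Fin.succ_ne_zero j).symm]
  | succ i =>
    by_cases h : i = j
    · subst h; simp [loopDeriv_succ, coeff_gen₁]; rfl
    · simp [loopDeriv_succ, coeff_gen₁, h, Ne.symm h]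

lemma coeff_diff₂_gen₂_up {i j : Fin N} (h : i ≠ j) (h' : i.castSucc ≠ j.succ) :
    coeff (diff₂ k N (gen₂ k i)) (some (.inl j)) = 0 := by
  simp [diff₂_gen₂, coeff_gen₁, coeff_loopDeriv_up, h', h.symm]

lemma coeff_diff₂ (u : Res₂ k N) (α : Arrow N) :
    coeff (diff₂ k N u) α = ∑ i, coeff u i * coeff (diff₂ k N (gen₂ k i)) α := by
  rw [map_eq_sum (fun _ ↦ pairIdem_mul_self ..) (diff₂ k N) u]
  simp [gen₂]

/-- The system is triangular. The loop coefficient involves only relation `0`, and the coefficient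
at `p m` only relations `m` and `m + 1`, so the coordinates of `u` vanish one after the other. -/
lemma diff₂_injective : Function.Injective (diff₂ k N) := by
  rw [injective_iff_map_eq_zero]
  intro u hu
  have hc : ∀ α, ∑ i, coeff u i * coeff (diff₂ k N (gen₂ k i)) α = 0 := fun α ↦ by
    rw [← coeff_diff₂, hu]; simp
  have key : ∀ (m : ℕ) (h : m < N), coeff u ⟨m, h⟩ = 0 := by
    intro m
    induction m with
    | zero =>
      intro h
      have h0 := hc none
      rw [Finset.sum_eq_single ⟨0, h⟩ _ (by simp)] at h0
      · have h1 := coeff_mul u ⟨0, h⟩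
        rw [← h1]
        simpa [diff₂_gen₂, coeff_gen₁, coeff_loopDeriv_none] using h0
      · intro i _ hi
        have : i.castSucc ≠ 0 := fun h' ↦ hi (Fin.ext (by simpa using congrArg Fin.val h'))
        simp [diff₂_gen₂, coeff_gen₁, coeff_loopDeriv_none, this]
    | succ m ih =>
      intro h
      have h0 := hc (some (.inl ⟨m, by omega⟩))
      rw [Finset.sum_eq_single ⟨m + 1, h⟩ _ (by simp)] at h0
      · have h1 := coeff_mul u ⟨m + 1, h⟩
        have h2 : coeff u ⟨m + 1, h⟩ * (ten k 1 (down k ⟨m, by omega⟩) *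
            pairIdem k (Fin.succ ⟨m, by omega⟩) (Fin.castSucc ⟨m, by omega⟩)) = 0 := by
          simpa [diff₂_gen₂, coeff_gen₁, coeff_loopDeriv_up] using h0
        -- The entry at relation `m + 1` is `1 ⊗ q` up to sign; a further factor `1 ⊗ p` turns it
        -- into the regular element `1 ⊗ z`.
        have h3 : ten k 1 (down k ⟨m, by omega⟩) *
            pairIdem k (Fin.succ ⟨m, by omega⟩) (Fin.castSucc ⟨m, by omega⟩) *
            ten k 1 (up k ⟨m, by omega⟩) =
            pairIdem k (Fin.castSucc ⟨m + 1, h⟩) (Fin.castSucc ⟨m + 1, h⟩) * ten k 1 (ctr k N) := by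
          rw [pairIdem, pairIdem, ten_mul_ten, ten_mul_ten, ten_mul_ten, ctr_mul_idem,
            idem_mul_down, up_mul_down]
          simp
        refine eq_zero_of_mul_ten_one (z := ctr k N) (fun a ha ↦ eq_zero_of_mul_ctr ?_) ?_
        · rw [← (ctr_commute k a).eq, ha]
        · rw [← h1, mul_assoc, ← h3, ← mul_assoc, h2, zero_mul]
      · intro i _ hi
        by_cases him : i = ⟨m, by omega⟩
        · rw [him, ih, zero_mul]
        · have : i.castSucc ≠ Fin.succ ⟨m, by omega⟩ :=
            fun h' ↦ hi (Fin.ext (by simpa using congrArg Fin.val h'))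
          rw [coeff_diff₂_gen₂_up k him this, mul_zero]
  ext i
  simpa using key i i.2

end injectivity

/-! ### The cochain complex in terms of polynomials -/

section coefficients

open Polynomial

lemma path_mul_idem (i j : Fin (N + 1)) : path k i j * idem k j = path k i j := by
  rw [path]; split_ifs <;> simp [mul_assoc]

lemma pairIdem_smul (i j : Fin (N + 1)) (a : PathAlg k N) :
    pairIdem k i j • a = idem k i * a * idem k j := ten_smul _ _ _

variable {k} {ι : Type} [Fintype ι] [DecidableEq ι] (t s : ι → Fin (N + 1))

/-- The linear map that sends each generator to a multiple of the shortest path. -/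
def pathHom : (ι → k[X]) →ₗ[k]
    (IdemModule (fun i ↦ pairIdem k (t i) (s i)) →ₗ[Env k (PathAlg k N)] PathAlg k N) where
  toFun c := IdemModule.lift _ fun i ↦ ev k N (c i) * path k (t i) (s i)
  map_add' c d := by
    ext u
    simp [IdemModule.lift_apply, add_mul, Finset.sum_add_distrib]
  map_smul' r c := by
    ext u
    simp only [IdemModule.lift_apply, LinearMap.smul_apply, Finset.smul_sum, Pi.smul_apply,
      map_smul, smul_mul_assoc, RingHom.id_apply]
    exact Finset.sum_congr rfl fun i _ ↦ smul_comm ..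

lemma pathHom_gen (c : ι → k[X]) (i : ι) :
    pathHom t s c (IdemModule.gen (fun _ ↦ pairIdem_mul_self ..) i) =
      ev k N (c i) * path k (t i) (s i) := by
  change IdemModule.lift _ _ _ = _
  rw [IdemModule.lift_gen, pairIdem_smul, ← mul_assoc, ← (ev_commute (c i) _).eq, mul_assoc,
    mul_assoc, path_mul_idem, idem_mul_path]

lemma pathHom_injective : Function.Injective (pathHom (k := k) t s) := by
  rw [injective_iff_map_eq_zero]
  intro c hc
  funext i
  refine ev_mul_path_injective (t i) (s i) ?_
  rw [← pathHom_gen t s c i, hc]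
  rfl

/-- A generator is fixed by its pair of idempotents, so its image lies in one component of the
algebra, where every element is a polynomial in `z` times the shortest path. -/
lemma pathHom_surjective : Function.Surjective (pathHom (k := k) t s) := by
  intro g
  have h : ∀ i, ∃ f : k[X], g (IdemModule.gen (fun _ ↦ pairIdem_mul_self ..) i) =
      ev k N f * path k (t i) (s i) := by
    intro i
    obtain ⟨f, hf⟩ := exists_component
      (g (IdemModule.gen (fun _ ↦ pairIdem_mul_self ..) i)) (t i) (s i)
    refine ⟨f, ?_⟩
    rw [← hf, ← pairIdem_smul]
    exact (IdemModule.smul_map_gen (ε := fun i ↦ pairIdem k (t i) (s i)) _ g i).symm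
  choose c hc using h
  refine ⟨c, IdemModule.hom_ext (fun _ ↦ pairIdem_mul_self ..) fun i ↦ ?_⟩
  rw [pathHom_gen, hc]

variable (k N) in
/-- The cochains of degree zero. -/
abbrev cochain₀ : (Fin (N + 1) → k[X]) →ₗ[k] (Res₀ k N →ₗ[Env k (PathAlg k N)] PathAlg k N) :=
  pathHom (fun i ↦ i) (fun i ↦ i)

variable (k N) in
/-- The cochains of degree one. -/
abbrev cochain₁ : (Arrow N → k[X]) →ₗ[k] (Res₁ k N →ₗ[Env k (PathAlg k N)] PathAlg k N) :=
  pathHom tgt src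

variable (k N) in
/-- The cochains of degree two. -/
abbrev cochain₂ : (Fin N → k[X]) →ₗ[k] (Res₂ k N →ₗ[Env k (PathAlg k N)] PathAlg k N) :=
  pathHom Fin.castSucc Fin.castSucc

lemma cochain₀_gen₀ (g : Fin (N + 1) → k[X]) (i : Fin (N + 1)) :
    cochain₀ k N g (gen₀ k i) = ev k N (g i) * idem k i := by
  rw [← path_self]; exact pathHom_gen _ _ g i

lemma cochain₁_gen₁ (c : Arrow N → k[X]) (α : Arrow N) :
    cochain₁ k N c (gen₁ k α) = ev k N (c α) * path k (tgt α) (src α) := pathHom_gen _ _ c α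

lemma cochain₂_gen₂ (h : Fin N → k[X]) (i : Fin N) :
    cochain₂ k N h (gen₂ k i) = ev k N (h i) * idem k i.castSucc := by
  rw [← path_self]; exact pathHom_gen _ _ h i

/-- The differential on cochains of degree zero. -/
def codiff₀ (g : Fin (N + 1) → k[X]) : Arrow N → k[X]
  | none => 0
  | some (.inl i) => g i.castSucc - g i.succ
  | some (.inr i) => g i.succ - g i.castSucc

lemma cochain₀_comp_diff₁ (g : Fin (N + 1) → k[X]) :
    cochain₀ k N g ∘ₗ diff₁ k N = cochain₁ k N (codiff₀ g) := by
  refine IdemModule.hom_ext (fun _ ↦ pairIdem_mul_self ..) fun α ↦ ?_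
  change cochain₀ k N g (diff₁ k N (gen₁ k α)) = cochain₁ k N (codiff₀ g) (gen₁ k α)
  rw [diff₁_gen₁, cochain₁_gen₁, map_sub, map_smul, map_smul, cochain₀_gen₀, cochain₀_gen₀,
    ten_smul, ten_smul, mul_one, one_mul, mul_assoc, idem_tgt_mul_arr, ← mul_assoc,
    ← (ev_commute _ (arr k α)).eq, mul_assoc, arr_mul_idem_src, ← sub_mul, ← map_sub]
  rcases α with _ | i | i <;> simp [codiff₀, src, tgt, arr]

/-- The coefficient of a derivation at the loop of a vertex. -/
def loopCoeff (c : Arrow N → k[X]) : Fin (N + 1) → k[X] :=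
  Fin.cases (c none) fun j ↦ (c (some (.inl j)) + c (some (.inr j))) * X

lemma cochain₁_loopDeriv (c : Arrow N → k[X]) (i : Fin (N + 1)) :
    cochain₁ k N c (loopDeriv k i) = ev k N (loopCoeff c i) * idem k i := by
  cases i using Fin.cases with
  | zero =>
    refine (cochain₁_gen₁ c none).trans ?_
    simp [loopCoeff, tgt, src]
  | succ j =>
    simp only [loopDeriv, loopCoeff, Fin.cases_succ, map_add, map_smul, cochain₁_gen₁, ten_smul,
      tgt, src, path_succ_castSucc, path_castSucc_succ, one_mul, mul_one, map_mul, aeval_X]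
    rw [← mul_assoc, ← (ev_commute _ (up k j)).eq, mul_assoc, mul_assoc, up_mul_down, mul_assoc,
      ctr_mul_idem, add_mul, add_comm]

/-- Differentiating `q p` gives `c (p) + c (q)` times `q p = z e`. At an inner vertex `loopCoeff`
has the same shape for the previous strand, so the result is divisible by `X`; at vertex `0` it is
the free coefficient of the loop. -/
lemma cochain₁_comp_diff₂ (c : Arrow N → k[X]) :
    cochain₁ k N c ∘ₗ diff₂ k N = cochain₂ k N fun i ↦
      (c (some (.inl i)) + c (some (.inr i))) * X - loopCoeff c i.castSucc := by
  refine IdemModule.hom_ext (fun _ ↦ pairIdem_mul_self ..) fun i ↦ ?_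
  change cochain₁ k N c (diff₂ k N (gen₂ k i)) = cochain₂ k N _ (gen₂ k i)
  rw [diff₂_gen₂, cochain₂_gen₂, map_sub, cochain₁_loopDeriv, ev, ev, map_sub, sub_mul]
  congr 1
  simp only [map_add, map_smul, cochain₁_gen₁, ten_smul,
      tgt, src, path_succ_castSucc, path_castSucc_succ, one_mul, mul_one, map_mul, aeval_X]
  rw [← mul_assoc, ← (ev_commute _ (down k i)).eq, mul_assoc, mul_assoc, down_mul_up, mul_assoc,
      ctr_mul_idem, add_mul]

end coefficients

end KLRW

/-! ### Computation of the cohomology groups -/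

namespace KLRW

open Polynomial CategoryTheory.Abelian

variable (k : Type u) [Field k] (N : ℕ)

/-- Multiplication by a polynomial in the central element, as an endomorphism of the diagonal
bimodule. -/
def centralHom : k[X] →ₗ[k] (PathAlg k N →ₗ[Env k (PathAlg k N)] PathAlg k N) where
  toFun f :=
    { toFun a := ev k N f * a
      map_add' a b := mul_add _ _ _
      map_smul' x a := by
        induction x using ten_induction with
        | zero => simp
        | ten b c =>
          rw [RingHom.id_apply, ten_smul, ten_smul, ← mul_assoc, ← mul_assoc, ← mul_assoc,
            (ev_commute f b).eq]
        | add x y hx hy => rw [add_smul, mul_add, hx, hy, RingHom.id_apply, RingHom.id_apply,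
            RingHom.id_apply, add_smul] }
  map_add' f g := by ext a; simp [add_mul]
  map_smul' r f := by ext a; simp

lemma centralHom_apply (f : k[X]) (a : PathAlg k N) : centralHom k N f a = ev k N f * a := rfl

lemma centralHom_injective : Function.Injective (centralHom k N) := by
  rw [injective_iff_map_eq_zero]
  intro f hf
  exact ev_mul_idem_injective (N := N) 0 (LinearMap.congr_fun hf (idem k 0))

variable {k N} in
/-- The center consists of the polynomials in the central element. -/
lemma exists_eq_ev_of_central (a : PathAlg k N) (ha : ∀ b, b * a = a * b) :
    ∃ f : k[X], a = ev k N f := by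
  have h : ∀ i : Fin (N + 1), ∃ f : k[X], idem k i * a * idem k i = ev k N f * idem k i := by
    intro i
    simpa using exists_component a i i
  choose f hf using h
  have hf' : ∀ i, a * idem k i = ev k N (f i) * idem k i := by
    intro i
    rw [← hf, ha, mul_assoc, idem_mul_self]
  -- Commuting with the arrow `i ⟶ i + 1` forces the polynomials at its two ends to agree.
  have hstep : ∀ i : Fin N, f i.succ = f i.castSucc := by
    intro i
    rw [← sub_eq_zero]
    refine ev_mul_path_injective i.succ i.castSucc ?_
    have h1 : a * up k i = ev k N (f i.succ) * up k i := by
      rw [← idem_mul_up, ← mul_assoc, ← mul_assoc, hf']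
    have h2 : up k i * a = ev k N (f i.castSucc) * up k i := by
      rw [← up_mul_idem, mul_assoc, ha (idem k _), hf', ← mul_assoc, ← (ev_commute _ (up k i)).eq,
        mul_assoc]
    rw [path_succ_castSucc, ev, map_sub, sub_mul, ← h1, ← h2, ha, sub_self]
  have hconst : ∀ i, f i = f 0 := by
    intro i
    induction i using Fin.induction with
    | zero => rfl
    | succ i ih => rw [hstep, ih]
  refine ⟨f 0, ?_⟩
  rw [← mul_one a, ← sum_idem, Finset.mul_sum, Finset.sum_congr rfl fun i _ ↦ hf' i]
  simp_rw [hconst]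
  rw [← Finset.mul_sum, sum_idem, mul_one]

/-- A bimodule endomorphism is multiplication by the image of `1`, and that image is central. -/
lemma centralHom_surjective : Function.Surjective (centralHom k N) := by
  intro φ
  have hl : ∀ b, φ b = b * φ 1 := fun b ↦ by
    simpa [ten_smul] using map_smul φ (ten k b 1) 1
  have hr : ∀ b, φ b = φ 1 * b := fun b ↦ by
    simpa [ten_smul] using map_smul φ (ten k 1 b) 1
  obtain ⟨f, hf⟩ := exists_eq_ev_of_central (φ 1) fun b ↦ by rw [← hl, ← hr]
  refine ⟨f, LinearMap.ext fun b ↦ ?_⟩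
  rw [centralHom_apply, hr, hf]

/-- The cocycle of the Euler derivation, multiplied by a polynomial. -/
def eulerCochain : k[X] →ₗ[k] (Arrow N → k[X]) := LinearMap.pi fun
  -- For `N ≥ 1` the relation at vertex `0` forces the loop coefficient `X * f`; for `N = 0` no
  -- relation constrains it.
  | none => LinearMap.mulLeft k (if N = 0 then 1 else X)
  | some (.inl _) => LinearMap.id
  | some (.inr _) => 0

lemma eulerCochain_mem (f : k[X]) : cochain₁ k N (eulerCochain k N f) ∈
    LinearMap.ker (LinearMap.lcomp k (PathAlg k N) (diff₂ k N)) := by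
  change cochain₁ k N (eulerCochain k N f) ∘ₗ diff₂ k N = 0
  rw [cochain₁_comp_diff₂, ← map_zero (cochain₂ k N)]
  congr 1
  funext i
  obtain ⟨n, rfl⟩ : ∃ n, N = n + 1 := Nat.exists_eq_succ_of_ne_zero fun h ↦ by
    subst h; exact i.elim0
  cases i using Fin.cases with
  | zero => simp [eulerCochain, loopCoeff, mul_comm]
  | succ j => simp [eulerCochain, loopCoeff]

/-- For `N ≥ 1`, cancelling `X` makes all sums `c (p i) + c (q i)` equal to one `f`. What remains is
the freedom in the `c (q i)`, and any such family consists of successive differences of its partial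
sums. -/
lemma exists_eulerCochain_add (c : Arrow N → k[X])
    (hc : ∀ i : Fin N, (c (some (.inl i)) + c (some (.inr i))) * X = loopCoeff c i.castSucc) :
    ∃ (f : k[X]) (g : Fin (N + 1) → k[X]), c = eulerCochain k N f + codiff₀ g := by
  rcases N with _ | n
  · refine ⟨c none, 0, funext ?_⟩
    rintro (_ | i | i)
    · simp [eulerCochain, codiff₀]
    · exact i.elim0
    · exact i.elim0
  let b (j : ℕ) : k[X] := if h : j < n + 1 then c (some (.inr ⟨j, h⟩)) else 0
  have hb : ∀ i : Fin (n + 1), b i = c (some (.inr i)) := fun i ↦ dif_pos i.2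
  let f := c (some (.inl 0)) + c (some (.inr 0))
  have hconst : ∀ i : Fin (n + 1), c (some (.inl i)) + c (some (.inr i)) = f := by
    intro i
    induction i using Fin.induction with
    | zero => rfl
    | succ i ih =>
      have := hc i.succ
      rw [← Fin.succ_castSucc] at this
      simp only [loopCoeff, Fin.cases_succ] at this
      rw [mul_right_cancel₀ X_ne_zero this, ih]
  refine ⟨f, fun i ↦ ∑ j ∈ Finset.range i, b j, funext ?_⟩
  rintro (_ | i | i)
  · have := hc 0
    simp only [loopCoeff, Fin.castSucc_zero, Fin.cases_zero] at this
    simp [eulerCochain, codiff₀, ← this, f, mul_comm X, add_mul]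
  · simp [eulerCochain, codiff₀, Finset.sum_range_succ, hb, ← hconst i]
  · simp [eulerCochain, codiff₀, Finset.sum_range_succ, hb]

/-- The map from constants to cochains of degree two supported at inner vertices. -/
def innerCochain (n : ℕ) : (Fin n → k) →ₗ[k] (Fin (n + 1) → k[X]) :=
  LinearMap.pi (Fin.cases 0 fun j ↦ (monomial 0 : k →ₗ[k] k[X]) ∘ₗ LinearMap.proj j)

lemma innerCochain_zero (n : ℕ) (a : Fin n → k) : innerCochain k n a 0 = 0 := rfl

lemma innerCochain_succ (n : ℕ) (a : Fin n → k) (j : Fin n) :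
    innerCochain k n a j.succ = C (a j) := rfl

/-- The loop coefficient removes the value at vertex `0`. At inner vertices the partial sums of the
quotients by `X` remove everything except the constant term. -/
lemma exists_innerCochain_add (n : ℕ) (h : Fin (n + 1) → k[X]) :
    ∃ (a : Fin n → k) (c : Arrow (n + 1) → k[X]), h = innerCochain k n a + fun i ↦
      (c (some (.inl i)) + c (some (.inr i))) * X - loopCoeff c i.castSucc := by
  let b (j : ℕ) : k[X] := if h' : j + 1 < n + 1 then divX (h ⟨j + 1, h'⟩) else 0
  have hb : ∀ j : Fin n, b j = divX (h j.succ) := fun j ↦ by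
    exact dif_pos (Nat.succ_lt_succ j.2)
  refine ⟨fun j ↦ (h j.succ).coeff 0, fun
    | none => - h 0
    | some (.inl i) => ∑ j ∈ Finset.range i, b j
    | some (.inr _) => 0, funext fun i ↦ ?_⟩
  cases i using Fin.cases with
  | zero => simp [innerCochain_zero, loopCoeff]
  | succ j =>
    rw [Pi.add_apply, innerCochain_succ, ← Fin.succ_castSucc]
    simp only [loopCoeff, Fin.cases_succ, Fin.val_succ, Finset.sum_range_succ, hb, add_zero,
      Fin.val_castSucc]
    rw [← sub_mul, add_sub_cancel_left, add_comm, divX_mul_X_add]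

/-- Coboundaries are divisible by `X` at inner vertices, so their constant terms vanish there. -/
lemma innerCochain_eq_zero (n : ℕ) (a : Fin n → k) (c : Arrow (n + 1) → k[X])
    (h : innerCochain k n a = fun i ↦
      (c (some (.inl i)) + c (some (.inr i))) * X - loopCoeff c i.castSucc) : a = 0 := by
  funext j
  have := congrArg (fun f ↦ coeff f 0) (congrFun h j.succ)
  rw [← Fin.succ_castSucc] at this
  simpa [innerCochain_succ, loopCoeff] using this

/-- Self-extensions of the diagonal bimodule. -/
abbrev SelfExt (n : ℕ) : Type u :=
  Ext.{u} (ModuleCat.of (Env k (PathAlg k N)) (PathAlg k N))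
    (ModuleCat.of (Env k (PathAlg k N)) (PathAlg k N)) n

lemma nonempty_selfExt_zero : Nonempty (SelfExt k N 0 ≃ₗ[k] k[X]) :=
  ⟨(ModuleCat.homEquivExt k (PathAlg k N) (PathAlg k N)).symm.trans
    (LinearEquiv.ofBijective (centralHom k N)
      ⟨centralHom_injective k N, centralHom_surjective k N⟩).symm⟩

lemma nonempty_selfExt_one : Nonempty (SelfExt k N 1 ≃ₗ[k] k[X]) := by
  obtain ⟨δ, hδ, hδ0⟩ := ModuleCat.exists_ext_one k (Y := PathAlg k N)
    (augmentation_surjective k (N := N)) (exact_diff₁_augmentation k) (exact_diff₂_diff₁ k)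
  let θ : k[X] →ₗ[k] LinearMap.ker (LinearMap.lcomp k (PathAlg k N) (diff₂ k N)) :=
    (cochain₁ k N ∘ₗ eulerCochain k N).codRestrict _ (eulerCochain_mem k N)
  refine ⟨(LinearEquiv.ofBijective (δ ∘ₗ θ) ⟨?_, ?_⟩).symm⟩
  · rw [injective_iff_map_eq_zero]
    intro f hf
    obtain ⟨g, hg⟩ := (hδ0 _).1 hf
    obtain ⟨g, rfl⟩ := pathHom_surjective _ _ g
    rw [cochain₀_comp_diff₁] at hg
    -- A coboundary of degree one has zero loop coefficient, while that of the Euler cocycle is a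
    -- nonzero multiple of `f`.
    have h := congrFun (pathHom_injective _ _ hg) none
    have h' : (if N = 0 then (1 : k[X]) else X) * f = 0 := h.symm
    split_ifs at h' with h0
    · simpa using h'
    · simpa using h'
  · intro x
    obtain ⟨⟨z, hz⟩, rfl⟩ := hδ x
    obtain ⟨c, rfl⟩ := pathHom_surjective _ _ z
    have hc : cochain₁ k N c ∘ₗ diff₂ k N = 0 := hz
    rw [cochain₁_comp_diff₂, ← map_zero (cochain₂ k N)] at hc
    have hc' := pathHom_injective _ _ hc
    obtain ⟨f, g, rfl⟩ := exists_eulerCochain_add k N c fun i ↦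
      sub_eq_zero.1 (congrFun hc' i)
    refine ⟨f, ?_⟩
    rw [LinearMap.comp_apply, ← sub_eq_zero, ← map_sub, hδ0]
    refine ⟨cochain₀ k N (-g), ?_⟩
    rw [map_neg, LinearMap.neg_comp, cochain₀_comp_diff₁]
    change _ = cochain₁ k N (eulerCochain k N f) - cochain₁ k N _
    rw [map_add, sub_add_cancel_left]

lemma nonempty_selfExt_two (n : ℕ) : Nonempty (SelfExt k (n + 1) 2 ≃ₗ[k] (Fin n → k)) := by
  obtain ⟨δ, hδ, hδ0⟩ := ModuleCat.exists_ext_two k (Y := PathAlg k (n + 1))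
    (augmentation_surjective k (N := n + 1)) (exact_diff₁_augmentation k) (exact_diff₂_diff₁ k)
    (diff₂_injective k)
  refine ⟨(LinearEquiv.ofBijective (δ ∘ₗ cochain₂ k (n + 1) ∘ₗ innerCochain k n) ⟨?_, ?_⟩).symm⟩
  · rw [injective_iff_map_eq_zero]
    intro a ha
    obtain ⟨c, hc⟩ := (hδ0 _).1 ha
    obtain ⟨c, rfl⟩ := pathHom_surjective _ _ c
    rw [cochain₁_comp_diff₂] at hc
    exact innerCochain_eq_zero k n a c (pathHom_injective _ _ hc).symm
  · intro x
    obtain ⟨z, rfl⟩ := hδ x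
    obtain ⟨h, rfl⟩ := pathHom_surjective _ _ z
    obtain ⟨a, c, rfl⟩ := exists_innerCochain_add k n h
    refine ⟨a, ?_⟩
    rw [LinearMap.comp_apply, LinearMap.comp_apply, ← sub_eq_zero, ← map_sub, hδ0]
    refine ⟨cochain₁ k (n + 1) (-c), ?_⟩
    rw [map_neg, LinearMap.neg_comp, cochain₁_comp_diff₂, map_add, sub_add_cancel_left]

lemma subsingleton_selfExt (n : ℕ) (hn : 3 ≤ n) : Subsingleton (SelfExt k N n) :=
  ModuleCat.subsingleton_ext (augmentation_surjective k) (exact_diff₁_augmentation k)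
    (exact_diff₂_diff₁ k) (diff₂_injective k) n hn

end KLRW

end

theorem mainTheorem1 (k : Type u) [Field k] (N : ℕ) :
    Nonempty (HochschildCohomology k (KLRW.Alg k N) 0 ≃ₗ[k] (ℕ →₀ k)) ∧
    Nonempty (HochschildCohomology k (KLRW.Alg k N) 1 ≃ₗ[k] (ℕ →₀ k)) ∧
    (1 ≤ N → Nonempty (HochschildCohomology k (KLRW.Alg k N) 2 ≃ₗ[k] (Fin (N - 1) → k))) ∧
    (∀ n : ℕ, 3 ≤ n → Subsingleton (HochschildCohomology k (KLRW.Alg k N) n)) := by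
  obtain ⟨e₀⟩ := KLRW.nonempty_selfExt_zero k N
  obtain ⟨e₁⟩ := KLRW.nonempty_selfExt_one k N
  -- `SelfExt` unfolds to `HochschildCohomology`, and the monomials identify `k[X]` with a countable
  -- direct sum of copies of `k`.
  refine ⟨⟨e₀.trans (Polynomial.basisMonomials k).repr⟩,
    ⟨e₁.trans (Polynomial.basisMonomials k).repr⟩, fun h ↦ ?_, KLRW.subsingleton_selfExt k N⟩
  obtain ⟨n, rfl⟩ := Nat.exists_eq_add_of_le' h
  exact KLRW.nonempty_selfExt_two k n
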